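/- **Notation.** All Hilbert spaces are real; $\rightharpoonup$ and $\to$ denote weak and strong convergence. For $\alpha>0$, $\mathcal P_\alpha(\mathcal H)$ is the set of bounded self-adjoint operators $U$ on $\mathcal H$ with $U\succcurlyeq\alpha\,\mathrm{Id}$, where $U\succcurlyeq V$ means $\langle Ux,x\rangle\ge\langle Vx,x\rangle$ for all $x$; $\sqrt U$ is the positive self-adjoint square root of $U$. For set-valued operators $A,B\colon\mathcal H\to2^{\mathcal H}$: $A^{-1}u=\{x: u\in Ax\}$, $\operatorname{ran}A=\bigcup_x Ax$, $J_A=(\mathrm{Id}+A)^{-1}$, $A\,\square\,B=(A^{-1}+B^{-1})^{-1}$; $A$ is monotone if $\langle x-y,u-v\rangle\ge0$ whenever $u\in Ax$, $v\in Ay$, and maximally monotone if in addition its graph is not properly contained in the graph of another monotone operator; $A$ is $\nu$-strongly monotone if $\langle x-y,u-v\rangle\ge\nu\|x-y\|^2$ whenever $u\in Ax$, $v\in Ay$. A map $C\colon\mathcal H\to\mathcal H$ is $\mu$-cocoercive if $\langle x-y,Cx-Cy\rangle\ge\mu\|Cx-Cy\|^2$ for all $x,y$. $A$ is demiregular at $x$,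 where $Ax\ne\varnothing$, if for all sequences with $u_n\in Ax_n$, $x_n\rightharpoonup x$ and $u_n\to u$ with $u\in Ax$, one has $x_n\to x$. **Problem.** Let $m\ge1$, let $\mathcal H,\mathcal G_1,\dots,\mathcal G_m$ be real Hilbert spaces, let $z\in\mathcal H$, let $A\colon\mathcal H\to2^{\mathcal H}$ be maximally monotone, let $\mu>0$ and let $C\colon\mathcal H\to\mathcal H$ be $\mu$-cocoercive. For $i=1,\dots,m$ let $r_i\in\mathcal G_i$, let $B_i\colon\mathcal G_i\to2^{\mathcal G_i}$ be maximally monotone, let $\nu_i>0$, let $D_i\colon\mathcal G_i\to2^{\mathcal G_i}$ be maximally monotone and $\nu_i$-strongly monotone, and let $L_i\colon\mathcal H\to\mathcal G_i$ be a nonzero bounded linear operator. The primal problem is to find $\overline x\in\mathcal H$ with $$z\in A\overline x+\sum_{i=1}^mL_i^*\big((B_i\,\square\,D_i)(L_i\overline x-r_i)\big)+C\overline x,\qquad(\mathrm P)$$ and the dual problem is to find $\overline v_i\in\mathcal G_i$ ($1\le i\le m$) such that $$(\exists x\in\mathcal H)\quad z-\sum_{i=1}^mL_i^*\overline v_i\in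 Ax+Cx\quad\text{and}\quad(\forall i)\ \ \overline v_i\in(B_i\,\square\,D_i)(L_ix-r_i).\qquad(\mathrm D)$$ **Corollary.** Suppose that $z\in\operatorname{ran}\big(A+\sum_iL_i^*((B_i\,\square\,D_i)(L_i\cdot-r_i))+C\big)$ and set $\beta=\min\{\mu,\nu_1,\dots,\nu_m\}$. Let $\varepsilon\in\,]0,\min\{1,\beta\}[$, let $\alpha>0$, let $x_0\in\mathcal H$, let $(a_n)_{n\in\mathbb N},(c_n)_{n\in\mathbb N}$ be absolutely summable sequences in $\mathcal H$, and let $(U_n)_{n\in\mathbb N}$ be a sequence in $\mathcal P_\alpha(\mathcal H)$ with $U_{n+1}\succcurlyeq U_n$ for all $n$. For every $i$, let $v_{i,0}\in\mathcal G_i$, let $(b_{i,n})_n,(d_{i,n})_n$ be absolutely summable sequences in $\mathcal G_i$, and let $(U_{i,n})_n$ be a sequence in $\mathcal P_\alpha(\mathcal G_i)$ with $U_{i,n+1}\succcurlyeq U_{i,n}$ for all $n$. For every $n\in\mathbb N$ set $$\delta_n=\Bigg(\sqrt{\sum_{i=1}^m\big\|\sqrt{U_{i,n}}\,L_i\sqrt{U_n}\big\|^2}\Bigg)^{-1}-1,\qquad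 \zeta_n=\frac{\delta_n}{(1+\delta_n)\max\{\|U_n\|,\|U_{1,n}\|,\dots,\|U_{m,n}\|\}},$$ and suppose that $$\zeta_n\ge\frac1{2\beta-\varepsilon}\qquad\text{and}\qquad\lambda_n\in\Big[\varepsilon,\;1+(1-\varepsilon)\Big(1-\frac1{2\zeta_n\beta}\Big)\Big].$$ Iterate, for $n=0,1,\dots$, $$\begin{aligned} p_n&=J_{U_nA}\Big(x_n-U_n\Big(\sum_{i=1}^mL_i^*v_{i,n}+Cx_n+c_n-z\Big)\Big)+a_n,\\ y_n&=2p_n-x_n,\\ x_{n+1}&=x_n+\lambda_n(p_n-x_n),\\ q_{i,n}&=J_{U_{i,n}B_i^{-1}}\Big(v_{i,n}+U_{i,n}\big(L_iy_n-D_i^{-1}v_{i,n}-d_{i,n}-r_i\big)\Big)+b_{i,n}\quad(1\le i\le m),\\ v_{i,n+1}&=v_{i,n}+\lambda_n(q_{i,n}-v_{i,n})\quad(1\le i\le m). \end{aligned}$$ Then this iteration is well defined (it generates exactly one sequence from the given starting points), and there are a solution $\overline x$ of $(\mathrm P)$ and a solution $(\overline v_1,\dots,\overline v_m)$ of $(\mathrm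 D)$ such that 1. $x_n\rightharpoonup\overline x$; 2. $v_{i,n}\rightharpoonup\overline v_i$ for every $i\in\{1,\dots,m\}$; 3. if $C$ is demiregular at $\overline x$, then $x_n\to\overline x$; 4. for every $j\in\{1,\dots,m\}$, if $D_j^{-1}$ is demiregular at $\overline v_j$, then $v_{j,n}\to\overline v_j$. -/

import Mathlib

open Filter Topology
open scoped Pointwise InnerProductSpace

namespace PrimalDual

section SetValued

variable {H : Type*} [NormedAddCommGroup H] [InnerProductSpace ℝ H]

/-- The inverse of a set-valued operator: `x ∈ A⁻¹ u ↔ u ∈ A x`. -/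
def inv {X Y : Type*} (A : X → Set Y) : Y → Set X := fun u => {x | u ∈ A x}

/-- The domain of a set-valued operator. -/
def dom {X Y : Type*} (A : X → Set Y) : Set X := {x | (A x).Nonempty}

/-- The range of a set-valued operator. -/
def ran {X Y : Type*} (A : X → Set Y) : Set Y := {u | ∃ x, u ∈ A x}

/-- A single-valued map seen as a set-valued operator. -/
def ofFun {X Y : Type*} (T : X → Y) : X → Set Y := fun x => {T x}

/-- The resolvent `J_A = (Id + A)⁻¹`, as a set-valued operator. -/
def resolvent (A : H → Set H) : H → Set H := inv (fun x => {x} + A x)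

/-- The composition `U A : x ↦ {U u | u ∈ A x}` of a linear operator with a set-valued one. -/
def linComp (U : H →L[ℝ] H) (A : H → Set H) : H → Set H := fun x => U '' A x

/-- The parallel sum `A □ B = (A⁻¹ + B⁻¹)⁻¹`. -/
def parallelSum (A B : H → Set H) : H → Set H := inv (fun u => inv A u + inv B u)

/-- Monotonicity of a set-valued operator. -/
def IsMonotoneOp (A : H → Set H) : Prop :=
  ∀ x y u v : H, u ∈ A x → v ∈ A y → 0 ≤ ⟪x - y, u - v⟫_ℝ

/-- Maximal monotonicity: no monotone operator has a strictly larger graph. -/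
def IsMaximallyMonotone (A : H → Set H) : Prop :=
  IsMonotoneOp A ∧ ∀ B : H → Set H, IsMonotoneOp B → (∀ x, A x ⊆ B x) → B = A

/-- Strong monotonicity with constant `ν`. -/
def IsStronglyMonotone (ν : ℝ) (A : H → Set H) : Prop :=
  ∀ x y u v : H, u ∈ A x → v ∈ A y → ν * ‖x - y‖ ^ 2 ≤ ⟪x - y, u - v⟫_ℝ

/-- Cocoercivity with constant `μ` of a single-valued operator. -/
def IsCocoercive (μ : ℝ) (C : H → H) : Prop :=
  ∀ x y : H, μ * ‖C x - C y‖ ^ 2 ≤ ⟪x - y, C x - C y⟫_ℝ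

/-- Weak convergence of a sequence. -/
def TendstoWeakly (x : ℕ → H) (l : H) : Prop :=
  Tendsto (fun n => toWeakSpace ℝ H (x n)) atTop (𝓝 (toWeakSpace ℝ H l))

/-- Demiregularity of `A` at a point `x` of its domain: whenever `(xₙ, uₙ)` is a sequence in the
graph of `A` with `xₙ ⇀ x` and `uₙ → u ∈ A x`, one has `xₙ → x`. -/
def IsDemiregularAt (A : H → Set H) (x : H) : Prop :=
  x ∈ dom A ∧ ∀ (xs us : ℕ → H) (u : H), (∀ n, us n ∈ A (xs n)) → u ∈ A x →
    TendstoWeakly xs x → Tendsto us atTop (𝓝 u) → Tendsto xs atTop (𝓝 x)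

/-- `𝒫_α(H)`: the bounded self-adjoint operators `U` with `U ≽ α Id` (Loewner order). -/
def coerciveOps (α : ℝ) (H : Type*) [NormedAddCommGroup H] [InnerProductSpace ℝ H]
    [CompleteSpace H] : Set (H →L[ℝ] H) :=
  {U | IsSelfAdjoint U ∧ α • ContinuousLinearMap.id ℝ H ≤ U}

open Classical in
/-- The square root of a positive self-adjoint operator `U`: the (unique) positive self-adjoint
operator whose square is `U`. -/
noncomputable def opSqrt (U : H →L[ℝ] H) : H →L[ℝ] H :=
  if h : ∃ S : H →L[ℝ] H, S.IsPositive ∧ S ∘L S = U then h.choose else 0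

end SetValued

section Problem

variable {m : ℕ} {H : Type*} [NormedAddCommGroup H] [InnerProductSpace ℝ H] [CompleteSpace H]
  {G : Fin m → Type*} [∀ i, NormedAddCommGroup (G i)] [∀ i, InnerProductSpace ℝ (G i)]
  [∀ i, CompleteSpace (G i)]

/-- The set-valued operator `x ↦ A x + ∑ i, Lᵢ* ((Bᵢ □ Dᵢ) (Lᵢ x - rᵢ)) + C x`
(Minkowski sums of sets). -/
noncomputable def primalOp (A : H → Set H) (C : H → H) (B D : ∀ i, G i → Set (G i))
    (L : ∀ i, H →L[ℝ] G i) (r : ∀ i, G i) : H → Set H :=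
  fun x => A x +
    ∑ i, (L i).adjoint '' (parallelSum (B i) (D i) (L i x - r i)) + {C x}

/-- `x` solves the primal inclusion. -/
def IsPrimalSolution (z : H) (A : H → Set H) (C : H → H) (B D : ∀ i, G i → Set (G i))
    (L : ∀ i, H →L[ℝ] G i) (r : ∀ i, G i) (x : H) : Prop :=
  z ∈ primalOp A C B D L r x

/-- `v = (v₁, …, vₘ)` solves the dual problem. -/
def IsDualSolution (z : H) (A : H → Set H) (C : H → H) (B D : ∀ i, G i → Set (G i))
    (L : ∀ i, H →L[ℝ] G i) (r : ∀ i, G i) (v : ∀ i, G i) : Prop :=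
  ∃ x : H, z - ∑ i, (L i).adjoint (v i) ∈ A x + {C x} ∧
    ∀ i, v i ∈ parallelSum (B i) (D i) (L i x - r i)

/-- `δ = (√(∑ i, ‖√Uᵢ Lᵢ √U‖²))⁻¹ - 1`. -/
noncomputable def deltaParam (L : ∀ i, H →L[ℝ] G i) (U : H →L[ℝ] H)
    (V : ∀ i, G i →L[ℝ] G i) : ℝ :=
  (Real.sqrt (∑ i, ‖opSqrt (V i) ∘L L i ∘L opSqrt U‖ ^ 2))⁻¹ - 1

/-- `ζ = δ / ((1 + δ) max {‖U‖, ‖U₁‖, …, ‖Uₘ‖})`. -/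
noncomputable def zetaParam (L : ∀ i, H →L[ℝ] G i) (U : H →L[ℝ] H)
    (V : ∀ i, G i →L[ℝ] G i) : ℝ :=
  deltaParam L U V / ((1 + deltaParam L U V) * max ‖U‖ (⨆ i, ‖V i‖))

/-- One step `(x, v) ↦ (x', v')` of the algorithm, with metrics `U`, `V i`, relaxation `lam` and
errors `a`, `c`, `b i`, `d i`. Resolvents and the operators `Dᵢ⁻¹` are used as set-valued
operators, so that an equation `p = J w + a` reads `p - a ∈ J w`. -/
def IsStep (z : H) (A : H → Set H) (C : H → H) (B D : ∀ i, G i → Set (G i))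
    (L : ∀ i, H →L[ℝ] G i) (r : ∀ i, G i)
    (U : H →L[ℝ] H) (V : ∀ i, G i →L[ℝ] G i) (lam : ℝ) (a c : H) (b d : ∀ i, G i)
    (x : H) (v : ∀ i, G i) (x' : H) (v' : ∀ i, G i) : Prop :=
  ∃ p y : H,
    p - a ∈ resolvent (linComp U A) (x - U (∑ i, (L i).adjoint (v i) + C x + c - z)) ∧
    y = (2 : ℝ) • p - x ∧
    x' = x + lam • (p - x) ∧
    ∀ i, ∃ w q : G i,
      w ∈ inv (D i) (v i) ∧
      q - b i ∈ resolvent (linComp (V i) (inv (B i)))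
        (v i + V i (L i y - w - d i - r i)) ∧
      v' i = v i + lam • (q - v i)

/-- The sequence of pairs `s n = (xₙ, (v₁ₙ, …, vₘₙ))` starts at `(x₀, v₀)` and is generated by the
algorithm. -/
def IsGenerated (z : H) (A : H → Set H) (C : H → H) (B D : ∀ i, G i → Set (G i))
    (L : ∀ i, H →L[ℝ] G i) (r : ∀ i, G i)
    (U : ℕ → H →L[ℝ] H) (V : ∀ i, ℕ → G i →L[ℝ] G i) (lam : ℕ → ℝ)
    (a c : ℕ → H) (b d : ∀ i, ℕ → G i) (x₀ : H) (v₀ : ∀ i, G i)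
    (s : ℕ → H × (∀ i, G i)) : Prop :=
  s 0 = (x₀, v₀) ∧
  ∀ n, IsStep z A C B D L r (U n) (fun i => V i n) (lam n) (a n) (c n)
    (fun i => b i n) (fun i => d i n) (s n).1 (s n).2 (s (n + 1)).1 (s (n + 1)).2

end Problem

end PrimalDual

/-! The iteration is a forward-backward method in disguise. In the Hilbert direct sum of `H` and the
`G i`, pairs formed by a primal solution and a compatible dual solution are the zeros of a sum of
three operators: `monoOp`, built from `A` and the `(B i)⁻¹` and maximally monotone; the bounded skew
operator `skewOp`; and `cocoOp`, built from `C` and the maps `(D i)⁻¹`, which is `β`-cocoercive. The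
last point uses that inverting a maximally monotone, strongly monotone operator gives an everywhere
defined cocoercive map (`exists_inv_eq_of_stronglyMonotone`).

One step of the algorithm is one forward-backward step for this sum in the metric `metricOp`, whose
diagonal blocks are the inverses of the `U n` and `V i n` and whose off-diagonal blocks `-L i`
cancel the coupling in `skewOp`, so that the blocks can be solved one after the other
(`IsStep.exists_mem_monoOp`). The number `ζ` is a coercivity constant of that metric
(`zetaParam_mul_norm_sq_le`), and growing `U n`, `V i n` make the metrics decrease.

Convergence is then a Fejér argument. In the current metric the distance to any zero decreases up to
summable errors, and the decrease controls both the residual and the variation of the cocoercive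
part (`tendsto_of_zero`). Hence every weak cluster point is a zero (`zero_of_weak_limit`), and since
the metrics converge pointwise, an Opial argument leaves only one (`weak_limit_unique`). The
cocoercive part converges strongly along the iterates, which is what demiregularity needs.

Well-definedness rests on Minty's theorem, obtained by minimising a quadratic perturbation over the
epigraph of the Fitzpatrick function. -/

namespace PrimalDual

/-! ### Positive operators: square roots, inverses and order -/

section Operators

variable {H : Type*} [NormedAddCommGroup H] [InnerProductSpace ℝ H]

/-- Evaluate the quadratic form of `W` at `x - M⁻¹ W x` and bound its quadratic term by `h1`. -/
theorem norm_map_sq_le_of_inner_le {W : H →L[ℝ] H} {M : ℝ} (hM : 0 < M)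
    (hW : ∀ x y, ⟪W x, y⟫_ℝ = ⟪x, W y⟫_ℝ) (h0 : ∀ x, 0 ≤ ⟪W x, x⟫_ℝ)
    (h1 : ∀ x, ⟪W x, x⟫_ℝ ≤ M * ‖x‖ ^ 2) (x : H) : ‖W x‖ ^ 2 ≤ M * ⟪W x, x⟫_ℝ := by
  have h := h0 (x - M⁻¹ • W x)
  have h2 := h1 (W x)
  have h3 : ⟪W (W x), x⟫_ℝ = ‖W x‖ ^ 2 := by rw [hW, real_inner_self_eq_norm_sq]
  simp only [map_sub, map_smul, inner_sub_left, inner_sub_right, real_inner_smul_left,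
    real_inner_smul_right, h3, real_inner_self_eq_norm_sq] at h
  have h4 : M⁻¹ * (M⁻¹ * ⟪W (W x), W x⟫_ℝ) ≤ M⁻¹ * ‖W x‖ ^ 2 := by
    calc _ ≤ M⁻¹ * (M⁻¹ * (M * ‖W x‖ ^ 2)) := by gcongr
      _ = _ := by field_simp
  have h5 : M⁻¹ * ‖W x‖ ^ 2 ≤ ⟪W x, x⟫_ℝ := by linarith
  calc ‖W x‖ ^ 2 = M * (M⁻¹ * ‖W x‖ ^ 2) := by field_simp
    _ ≤ _ := by gcongr

theorem inner_map_le_of_le {U V : H →L[ℝ] H} (h : U ≤ V) (x : H) : ⟪U x, x⟫_ℝ ≤ ⟪V x, x⟫_ℝ := by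
  have := ((ContinuousLinearMap.le_def U V).1 h).inner_nonneg_left x
  simpa [inner_sub_left] using this

variable [CompleteSpace H]

theorem inner_map_comm {U : H →L[ℝ] H} (hU : IsSelfAdjoint U) (x y : H) :
    ⟪U x, y⟫_ℝ = ⟪x, U y⟫_ℝ :=
  (ContinuousLinearMap.isSelfAdjoint_iff_isSymmetric.1 hU) x y

theorem le_inner_of_mem_coerciveOps {α : ℝ} {U : H →L[ℝ] H} (hU : U ∈ coerciveOps α H) (x : H) :
    α * ‖x‖ ^ 2 ≤ ⟪U x, x⟫_ℝ := by
  have := inner_map_le_of_le hU.2 x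
  simpa [real_inner_smul_left] using this

theorem mem_coerciveOps {α : ℝ} {U : H →L[ℝ] H} (h1 : ∀ x y, ⟪U x, y⟫_ℝ = ⟪x, U y⟫_ℝ)
    (h2 : ∀ x, α * ‖x‖ ^ 2 ≤ ⟪U x, x⟫_ℝ) : U ∈ coerciveOps α H := by
  refine ⟨ContinuousLinearMap.isSelfAdjoint_iff_isSymmetric.2 h1, ?_⟩
  rw [ContinuousLinearMap.le_def, ContinuousLinearMap.isPositive_iff]
  refine ⟨fun x y => ?_, fun x => ?_⟩
  · have := h1 x y
    simp [inner_sub_left, inner_sub_right, real_inner_smul_left, real_inner_smul_right] at this ⊢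
    exact this
  · simpa [inner_sub_left, real_inner_smul_left] using h2 x

theorem isUnit_of_mem_coerciveOps {α : ℝ} (hα : 0 < α) {U : H →L[ℝ] H}
    (hU : U ∈ coerciveOps α H) : IsUnit U := by
  refine ContinuousLinearMap.isUnit_of_forall_le_norm_inner_map U (c := ⟨α, hα.le⟩) hα fun x => ?_
  calc _ = α * ‖x‖ ^ 2 := mul_comm _ _
    _ ≤ _ := (le_inner_of_mem_coerciveOps hU x).trans (le_abs_self _)

theorem exists_inverse_of_mem_coerciveOps {α : ℝ} (hα : 0 < α) {U : H →L[ℝ] H}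
    (hU : U ∈ coerciveOps α H) : ∃ T : H →L[ℝ] H, (∀ x, U (T x) = x) ∧ ∀ x, T (U x) = x := by
  obtain ⟨u, rfl⟩ := isUnit_of_mem_coerciveOps hα hU
  refine ⟨↑u⁻¹, fun x => ?_, fun x => ?_⟩
  · exact DFunLike.congr_fun u.mul_inv x
  · exact DFunLike.congr_fun u.inv_mul x

/-- A positive square root of `1 - T` for a self-adjoint strict contraction `T`: it is `1 - X` with
`X = (T + X²) / 2`. -/
theorem exists_fixedPoint_sqrt {T : H →L[ℝ] H} (hT : IsSelfAdjoint T) {q : ℝ} (hq : q < 1)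
    (hTq : ‖T‖ ≤ q) : ∃ X : H →L[ℝ] H, IsSelfAdjoint X ∧ ‖X‖ ≤ q ∧
      X = (2⁻¹ : ℝ) • (T + X * X) := by
  have hq0 : 0 ≤ q := (norm_nonneg _).trans hTq
  let s : Set (H →L[ℝ] H) := {X | IsSelfAdjoint X} ∩ Metric.closedBall 0 q
  let f : (H →L[ℝ] H) → (H →L[ℝ] H) := fun X => (2⁻¹ : ℝ) • (T + X * X)
  have hs : IsComplete s := by
    refine (IsClosed.inter ?_ Metric.isClosed_closedBall).isComplete
    exact isClosed_eq continuous_star continuous_id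
  have hsf : Set.MapsTo f s s := by
    rintro X ⟨hX1, hX2⟩
    have hX2 : ‖X‖ ≤ q := by simpa using hX2
    refine ⟨?_, ?_⟩
    · have h2 : IsSelfAdjoint (X * X) := by
        have hX1 : star X = X := hX1
        simp [IsSelfAdjoint, hX1]
      exact IsSelfAdjoint.smul (.all _) (hT.add h2)
    · have : ‖T + X * X‖ ≤ q + q * q :=
        (norm_add_le _ _).trans (add_le_add hTq ((norm_mul_le _ _).trans (by gcongr)))
      simp only [mem_closedBall_zero_iff, f, norm_smul, norm_inv, Real.norm_ofNat]
      nlinarith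
  have hc : ContractingWith ⟨q, hq0⟩ (hsf.restrict f s s) := by
    refine ⟨by exact_mod_cast hq, LipschitzWith.of_dist_le_mul ?_⟩
    rintro ⟨X, hX1, hX2⟩ ⟨Y, hY1, hY2⟩
    have hX2 : ‖X‖ ≤ q := by simpa using hX2
    have hY2 : ‖Y‖ ≤ q := by simpa using hY2
    change dist (f X) (f Y) ≤ q * dist X Y
    have e : f X - f Y = (2⁻¹ : ℝ) • (X * (X - Y) + (X - Y) * Y) := by
      simp only [f, ← smul_sub]
      congr 1
      noncomm_ring
    rw [dist_eq_norm, dist_eq_norm, e, norm_smul, norm_inv, Real.norm_ofNat]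
    have h1 : ‖X * (X - Y)‖ ≤ q * ‖X - Y‖ := (norm_mul_le _ _).trans (by gcongr)
    have h2 : ‖(X - Y) * Y‖ ≤ ‖X - Y‖ * q := (norm_mul_le _ _).trans (by gcongr)
    have := norm_add_le (X * (X - Y)) ((X - Y) * Y)
    linarith
  have h0 : (0 : H →L[ℝ] H) ∈ s := ⟨IsSelfAdjoint.zero _, by simpa using hq0⟩
  obtain ⟨X, ⟨hX1, hX2⟩, hX3, -⟩ := ContractingWith.exists_fixedPoint' hs hsf hc h0 (edist_ne_top _ _)
  exact ⟨X, hX1, by simpa using hX2, hX3.symm⟩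

theorem exists_sqrt_of_mem_coerciveOps {α : ℝ} (hα : 0 < α) {U : H →L[ℝ] H}
    (hU : U ∈ coerciveOps α H) : ∃ S : H →L[ℝ] H, S.IsPositive ∧ S ∘L S = U := by
  -- The scale is chosen so that `‖U‖² ≤ c α`, which turns `1 - c⁻¹ U` into a strict contraction;
  -- the summand `α` keeps `c` at least `α`, hence positive.
  set c : ℝ := ‖U‖ ^ 2 / α + α with hc
  have hcα : α ≤ c := le_add_of_nonneg_left (by positivity)
  have hc0 : 0 < c := hα.trans_le hcα
  have hcU : ‖U‖ ^ 2 ≤ c * α := by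
    rw [hc, add_mul, div_mul_cancel₀ _ hα.ne']
    nlinarith
  set T : H →L[ℝ] H := 1 - c⁻¹ • U with hTdef
  have hT : IsSelfAdjoint T := (IsSelfAdjoint.one _).sub (IsSelfAdjoint.smul (.all _) hU.1)
  have hαc : α / c ≤ 1 := (div_le_one hc0).2 hcα
  have hαc' : 0 < α / c := by positivity
  have hTn : ‖T‖ ≤ √(1 - α / c) := by
    refine ContinuousLinearMap.opNorm_le_bound _ (Real.sqrt_nonneg _) fun x => ?_
    refine le_of_sq_le_sq ?_ (by positivity)
    have h1 : ‖T x‖ ^ 2 = ‖x‖ ^ 2 - 2 * (c⁻¹ * ⟪U x, x⟫_ℝ) + c⁻¹ ^ 2 * ‖U x‖ ^ 2 := by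
      have : T x = x - c⁻¹ • U x := by simp [hTdef]
      rw [this, norm_sub_sq_real, real_inner_smul_right, norm_smul, mul_pow, real_inner_comm]
      simp
    have h2 : ‖U x‖ ^ 2 ≤ c * α * ‖x‖ ^ 2 := by
      calc ‖U x‖ ^ 2 ≤ (‖U‖ * ‖x‖) ^ 2 := by gcongr; exact U.le_opNorm x
        _ = ‖U‖ ^ 2 * ‖x‖ ^ 2 := by ring
        _ ≤ _ := by gcongr
    have h3 : c⁻¹ ^ 2 * ‖U x‖ ^ 2 ≤ α / c * ‖x‖ ^ 2 := by
      calc _ ≤ c⁻¹ ^ 2 * (c * α * ‖x‖ ^ 2) := by gcongr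
        _ = _ := by field_simp
    have h4 : α / c * ‖x‖ ^ 2 ≤ c⁻¹ * ⟪U x, x⟫_ℝ := by
      calc _ = c⁻¹ * (α * ‖x‖ ^ 2) := by ring
        _ ≤ _ := by gcongr; exact le_inner_of_mem_coerciveOps hU x
    rw [mul_pow, Real.sq_sqrt (by linarith), h1]
    linarith
  have hq : √(1 - α / c) < 1 := by
    rw [Real.sqrt_lt' one_pos]
    linarith
  obtain ⟨X, hX1, hX2, hX3⟩ := exists_fixedPoint_sqrt hT hq hTn
  refine ⟨√c • (1 - X), ?_, ?_⟩
  · rw [ContinuousLinearMap.isPositive_iff']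
    refine ⟨IsSelfAdjoint.smul (.all _) ((IsSelfAdjoint.one _).sub hX1), fun x => ?_⟩
    have h1 : ⟪X x, x⟫_ℝ ≤ ‖x‖ ^ 2 := by
      calc _ ≤ ‖X x‖ * ‖x‖ := real_inner_le_norm _ _
        _ ≤ (1 * ‖x‖) * ‖x‖ := by
          gcongr
          exact X.le_of_opNorm_le (hX2.trans hq.le) x
        _ = _ := by ring
    simp only [smul_apply, sub_apply, one_apply_eq_self, real_inner_smul_left, inner_sub_left,
      real_inner_self_eq_norm_sq]
    exact mul_nonneg (Real.sqrt_nonneg _) (by linarith)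
  · have h2 : X + X = T + X * X := by
      conv_lhs => rw [hX3]
      rw [← add_smul]; norm_num
    have h3 : (1 - X) * (1 - X) = 1 - T := by
      calc (1 - X) * (1 - X) = 1 - (X + X) + X * X := by noncomm_ring
        _ = 1 - T := by rw [h2]; noncomm_ring
    change (√c • (1 - X)) * (√c • (1 - X)) = U
    rw [smul_mul_smul_comm, Real.mul_self_sqrt hc0.le, h3, hTdef, sub_sub_cancel, smul_smul,
      mul_inv_cancel₀ hc0.ne', one_smul]

theorem opSqrt_spec {α : ℝ} (hα : 0 < α) {U : H →L[ℝ] H} (hU : U ∈ coerciveOps α H) :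
    (opSqrt U).IsPositive ∧ ∀ x, opSqrt U (opSqrt U x) = U x := by
  have h := exists_sqrt_of_mem_coerciveOps hα hU
  have e : opSqrt U = h.choose := dif_pos h
  rw [e]
  exact ⟨h.choose_spec.1, fun x => DFunLike.congr_fun h.choose_spec.2 x⟩

theorem opSqrt_inner {α : ℝ} (hα : 0 < α) {U : H →L[ℝ] H} (hU : U ∈ coerciveOps α H) (x : H) :
    ‖opSqrt U x‖ ^ 2 = ⟪U x, x⟫_ℝ := by
  obtain ⟨h1, h2⟩ := opSqrt_spec hα hU
  rw [← h2, inner_map_comm h1.isSelfAdjoint, real_inner_self_eq_norm_sq]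

theorem isUnit_opSqrt {α : ℝ} (hα : 0 < α) {U : H →L[ℝ] H} (hU : U ∈ coerciveOps α H) :
    IsUnit (opSqrt U) := by
  have h : opSqrt U ^ 2 = U := by
    ext x; exact (opSqrt_spec hα hU).2 x
  refine (isUnit_pow_iff two_ne_zero).1 ?_
  rw [h]
  exact isUnit_of_mem_coerciveOps hα hU

theorem inverse_isSelfAdjoint {U T : H →L[ℝ] H} (hU : IsSelfAdjoint U)
    (h1 : ∀ x, U (T x) = x) (x y : H) : ⟪T x, y⟫_ℝ = ⟪x, T y⟫_ℝ := by
  rw [← h1 y, ← inner_map_comm hU, h1, h1]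

/-- Expand the nonnegative number `⟪U (T x - R x), T x - R x⟫` and replace `U` by the larger `V` in
its term `⟪U (R x), R x⟫`. This makes the metrics of the algorithm decrease. -/
theorem inner_inverse_antitone {α : ℝ} (hα : 0 < α) {U V T R : H →L[ℝ] H}
    (hU : U ∈ coerciveOps α H) (h : U ≤ V) (hT : ∀ x, U (T x) = x) (hR : ∀ x, V (R x) = x)
    (x : H) : ⟪R x, x⟫_ℝ ≤ ⟪T x, x⟫_ℝ := by
  have h1 := le_inner_of_mem_coerciveOps hU (T x - R x)
  have h2 := inner_map_le_of_le h (R x)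
  have h3 : 0 ≤ α * ‖T x - R x‖ ^ 2 := by positivity
  have h4 : ⟪U (R x), T x⟫_ℝ = ⟪R x, x⟫_ℝ := by rw [inner_map_comm hU.1, hT]
  rw [map_sub, hT, inner_sub_left, inner_sub_right, inner_sub_right, h4,
    real_inner_comm (T x) x, real_inner_comm (R x) x] at h1
  rw [hR, real_inner_comm (R x) x] at h2
  linarith

theorem norm_sq_le_norm_mul_inner_inverse {α : ℝ} (hα : 0 < α) {U T : H →L[ℝ] H}
    (hU : U ∈ coerciveOps α H) (hT : ∀ x, U (T x) = x) {M : ℝ} (hM : ‖U‖ ≤ M) (hM0 : 0 < M)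
    (x : H) : ‖x‖ ^ 2 ≤ M * ⟪T x, x⟫_ℝ := by
  have h := norm_map_sq_le_of_inner_le hM0 (inner_map_comm hU.1)
    (fun x => (by positivity : 0 ≤ α * ‖x‖ ^ 2).trans (le_inner_of_mem_coerciveOps hU x)) (fun x => ?_) (T x)
  · rwa [hT, real_inner_comm] at h
  · calc _ ≤ ‖U x‖ * ‖x‖ := real_inner_le_norm _ _
      _ ≤ (M * ‖x‖) * ‖x‖ := by gcongr; exact U.le_of_opNorm_le hM x
      _ = _ := by ring

end Operators

/-! ### Weak convergence and weak limits along ultrafilters -/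

section Weak

variable {H : Type*} [NormedAddCommGroup H] [InnerProductSpace ℝ H]

theorem tendsto_inner_of_weak_of_strong {F : Filter ℕ} {x u : ℕ → H} {l v : H} {R : ℝ}
    (hR : ∀ n, ‖x n‖ ≤ R) (hx : ∀ h, Tendsto (fun n => ⟪x n, h⟫_ℝ) F (𝓝 ⟪l, h⟫_ℝ))
    (hu : Tendsto u F (𝓝 v)) : Tendsto (fun n => ⟪x n, u n⟫_ℝ) F (𝓝 ⟪l, v⟫_ℝ) := by
  have h1 : Tendsto (fun n => ⟪x n, u n - v⟫_ℝ) F (𝓝 0) := by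
    have h2 : Tendsto (fun n => R * ‖u n - v‖) F (𝓝 0) := by
      have := (tendsto_iff_norm_sub_tendsto_zero.1 hu).const_mul R
      simpa using this
    refine squeeze_zero_norm (fun n => ?_) h2
    exact (norm_inner_le_norm _ _).trans (by gcongr; exact hR n)
  simpa [inner_sub_right] using h1.add (hx v)

variable [CompleteSpace H]

theorem tendstoWeakly_iff {x : ℕ → H} {l : H} :
    TendstoWeakly x l ↔ ∀ h, Tendsto (fun n => ⟪x n, h⟫_ℝ) atTop (𝓝 ⟪l, h⟫_ℝ) := by
  have key : TendstoWeakly x l ↔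
      ∀ g : StrongDual ℝ H, Tendsto (fun n => g (x n)) atTop (𝓝 (g l)) := by
    refine WeakBilin.tendsto_iff_forall_eval_tendsto _ ?_
    intro a b hab
    refine ext_inner_left ℝ fun h => ?_
    exact DFunLike.congr_fun hab (InnerProductSpace.toDual ℝ H h)
  rw [key]
  constructor
  · intro h y
    simpa [InnerProductSpace.toDual_apply_apply, real_inner_comm] using
      h (InnerProductSpace.toDual ℝ H y)
  · intro h g
    have e : ∀ y, g y = ⟪y, (InnerProductSpace.toDual ℝ H).symm g⟫_ℝ := fun y => by
      rw [real_inner_comm, InnerProductSpace.toDual_symm_apply]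
    simpa only [e] using h ((InnerProductSpace.toDual ℝ H).symm g)

/-- Bounded sequences have weak limits along ultrafilters. -/
theorem exists_weak_limit (F : Ultrafilter ℕ) {x : ℕ → H} {R : ℝ} (hx : ∀ n, ‖x n‖ ≤ R) :
    ∃ l : H, ∀ h, Tendsto (fun n => ⟪x n, h⟫_ℝ) F (𝓝 ⟪l, h⟫_ℝ) := by
  have hR : 0 ≤ R := (norm_nonneg _).trans (hx 0)
  have hb : ∀ h n, ⟪x n, h⟫_ℝ ∈ Metric.closedBall (0 : ℝ) (R * ‖h‖) := fun h n => by
    rw [mem_closedBall_zero_iff]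
    exact (norm_inner_le_norm _ _).trans (by gcongr; exact hx n)
  have hlim : ∀ h, ∃ y ∈ Metric.closedBall (0 : ℝ) (R * ‖h‖),
      Tendsto (fun n => ⟪x n, h⟫_ℝ) F (𝓝 y) := fun h =>
    (isCompact_closedBall (0 : ℝ) (R * ‖h‖)).ultrafilter_le_nhds (F.map fun n => ⟪x n, h⟫_ℝ)
      (by
        simp only [Ultrafilter.coe_map, le_principal_iff, mem_map]
        exact Filter.univ_mem' (hb h))
  choose φ hφ1 hφ2 using hlim
  -- The ultrafilter limits of the inner products depend linearly on the test vector and are bounded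
  -- by `R ‖h‖`, so Riesz representation yields the weak limit.
  let g : H →ₗ[ℝ] ℝ :=
    { toFun := φ
      map_add' := fun a b => tendsto_nhds_unique (hφ2 (a + b)) (by
        simpa only [inner_add_right] using (hφ2 a).add (hφ2 b))
      map_smul' := fun c a => tendsto_nhds_unique (hφ2 (c • a)) (by
        simpa only [real_inner_smul_right] using! (hφ2 a).const_mul c) }
  let G : StrongDual ℝ H := g.mkContinuous R fun h => mem_closedBall_zero_iff.1 (hφ1 h)
  refine ⟨(InnerProductSpace.toDual ℝ H).symm G, fun h => ?_⟩
  rw [InnerProductSpace.toDual_symm_apply]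
  exact hφ2 h

end Weak

/-! ### Minimising a linear plus quadratic function on a closed convex set -/

section Minimisation

variable {X : Type*} [NormedAddCommGroup X] [InnerProductSpace ℝ X]

/-- Compare `p` with the point `p + s (q - p)` of the segment, divide by `s` and let `s` tend to
`0`. -/
theorem first_order_of_minimiser {E : Set (X × ℝ)} (hc : Convex ℝ E) {p : X × ℝ} (hp : p ∈ E)
    (hmin : ∀ q ∈ E, p.2 + ‖p.1‖ ^ 2 / 2 ≤ q.2 + ‖q.1‖ ^ 2 / 2) {q : X × ℝ} (hq : q ∈ E) :
    0 ≤ q.2 - p.2 + ⟪p.1, q.1 - p.1⟫_ℝ := by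
  have h : ∀ s : ℝ, s ∈ Set.Ioc 0 1 →
      0 ≤ q.2 - p.2 + ⟪p.1, q.1 - p.1⟫_ℝ + s * (‖q.1 - p.1‖ ^ 2 / 2) := by
    rintro s ⟨hs0, hs1⟩
    have h1 := hmin _ (hc.add_smul_sub_mem hp hq ⟨hs0.le, hs1⟩)
    simp only [Prod.snd_add, Prod.smul_snd, Prod.snd_sub, smul_eq_mul, Prod.fst_add,
      Prod.smul_fst, Prod.fst_sub, norm_add_sq_real, real_inner_smul_right, norm_smul,
      mul_pow, Real.norm_eq_abs, sq_abs] at h1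
    refine nonneg_of_mul_nonneg_right ?_ hs0
    linarith
  have hl : Tendsto (fun s : ℝ => q.2 - p.2 + ⟪p.1, q.1 - p.1⟫_ℝ + s * (‖q.1 - p.1‖ ^ 2 / 2))
      (𝓝[>] 0) (𝓝 (q.2 - p.2 + ⟪p.1, q.1 - p.1⟫_ℝ + 0 * (‖q.1 - p.1‖ ^ 2 / 2))) :=
    Tendsto.mono_left (Continuous.tendsto (by fun_prop) 0) nhdsWithin_le_nhds
  rw [zero_mul, add_zero] at hl
  exact ge_of_tendsto hl (eventually_of_mem (Ioc_mem_nhdsGT one_pos) h)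

variable [CompleteSpace X]

/-- The function `(x, t) ↦ t + ‖x‖² / 2` attains its infimum on a closed convex set on which it is
nonnegative. -/
theorem exists_minimiser_add_norm_sq {E : Set (X × ℝ)} (hE : IsClosed E) (hc : Convex ℝ E)
    (hne : E.Nonempty) (hb : ∀ p ∈ E, 0 ≤ p.2 + ‖p.1‖ ^ 2 / 2) :
    ∃ p ∈ E, ∀ q ∈ E, p.2 + ‖p.1‖ ^ 2 / 2 ≤ q.2 + ‖q.1‖ ^ 2 / 2 := by
  set f : X × ℝ → ℝ := fun p => p.2 + ‖p.1‖ ^ 2 / 2 with hf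
  set m := sInf (f '' E) with hm
  have hbdd : BddBelow (f '' E) := ⟨0, by rintro _ ⟨p, hp, rfl⟩; exact hb p hp⟩
  have hmle : ∀ q ∈ E, m ≤ f q := fun q hq => csInf_le hbdd ⟨q, hq, rfl⟩
  have hex : ∀ n : ℕ, ∃ p ∈ E, f p < m + 1 / ((n : ℝ) + 1) := fun n => by
    obtain ⟨_, ⟨p, hp, rfl⟩, h⟩ := exists_lt_of_csInf_lt (hne.image f)
      (show m < m + 1 / ((n : ℝ) + 1) from lt_add_of_pos_right _ (by positivity))
    exact ⟨p, hp, h⟩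
  choose p hpE hp using hex
  -- Midpoints stay in `E`, so the parallelogram law makes the first components of a minimising
  -- sequence Cauchy; the second components then converge because the values do.
  have hdist : ∀ n k, ‖(p n).1 - (p k).1‖ ^ 2 ≤ 4 * (f (p n) + f (p k) - 2 * m) := fun n k => by
    have h := hmle _ (hc (hpE n) (hpE k) (show (0 : ℝ) ≤ 2⁻¹ by norm_num)
      (show (0 : ℝ) ≤ 2⁻¹ by norm_num) (by norm_num))
    have h2 := parallelogram_law_with_norm ℝ (p n).1 (p k).1
    simp only [hf, Prod.snd_add, Prod.smul_snd, smul_eq_mul, Prod.fst_add, Prod.smul_fst,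
      ← smul_add, norm_smul, norm_inv, Real.norm_ofNat, mul_pow] at h ⊢
    nlinarith
  have hcau : CauchySeq fun n => (p n).1 := by
    refine cauchySeq_of_le_tendsto_0 (fun N : ℕ => √(8 * (1 / ((N : ℝ) + 1)))) ?_ ?_
    · intro n k N hn hk
      rw [dist_eq_norm]
      refine Real.le_sqrt_of_sq_le ((hdist n k).trans ?_)
      have h1 : 1 / ((n : ℝ) + 1) ≤ 1 / ((N : ℝ) + 1) := by gcongr
      have h2 : 1 / ((k : ℝ) + 1) ≤ 1 / ((N : ℝ) + 1) := by gcongr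
      linarith [hp n, hp k]
    · have := (tendsto_one_div_add_atTop_nhds_zero_nat (𝕜 := ℝ)).const_mul 8
      simpa using this.sqrt
  obtain ⟨x, hx⟩ := cauchySeq_tendsto_of_complete hcau
  have hfm : Tendsto (fun n => f (p n)) atTop (𝓝 m) := by
    refine tendsto_of_tendsto_of_tendsto_of_le_of_le tendsto_const_nhds ?_
      (fun n => hmle _ (hpE n)) (fun n => (hp n).le)
    simpa using (tendsto_one_div_add_atTop_nhds_zero_nat (𝕜 := ℝ)).const_add m
  have ht : Tendsto (fun n => (p n).2) atTop (𝓝 (m - ‖x‖ ^ 2 / 2)) := by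
    have := hfm.sub ((hx.norm.pow 2).div_const 2)
    simpa [hf] using this
  refine ⟨(x, m - ‖x‖ ^ 2 / 2), hE.mem_of_tendsto (hx.prodMk_nhds ht) (.of_forall hpE), ?_⟩
  intro q hq
  simpa using hmle q hq

end Minimisation

/-! ### Maximally monotone operators: Minty's theorem and resolvents -/

section Monotone

variable {H : Type*} [NormedAddCommGroup H] [InnerProductSpace ℝ H]

theorem IsMaximallyMonotone.mem {A : H → Set H} (hA : IsMaximallyMonotone A) {x u : H}
    (h : ∀ y v, v ∈ A y → 0 ≤ ⟪x - y, u - v⟫_ℝ) : u ∈ A x := by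
  have := hA.2 (fun y => A y ∪ {v | y = x ∧ v = u}) ?_ (fun y => Set.subset_union_left)
  · rw [← this]; exact Or.inr ⟨rfl, rfl⟩
  · rintro y y' v v' (hv | ⟨rfl, rfl⟩) (hv' | ⟨rfl, rfl⟩)
    · exact hA.1 _ _ _ _ hv hv'
    · rw [← neg_sub, ← neg_sub v', inner_neg_neg]
      exact h _ _ hv
    · exact h _ _ hv'
    · simp

theorem isMaximallyMonotone_of_forall {A : H → Set H} (hA : IsMonotoneOp A)
    (h : ∀ x u, (∀ y v, v ∈ A y → 0 ≤ ⟪x - y, u - v⟫_ℝ) → u ∈ A x) : IsMaximallyMonotone A := by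
  refine ⟨hA, fun B hB hAB => ?_⟩
  funext x
  refine Set.Subset.antisymm (fun u hu => ?_) (hAB x)
  exact h x u fun y v hv => hB _ _ _ _ hu (hAB y hv)

theorem IsMaximallyMonotone.inv {A : H → Set H} (hA : IsMaximallyMonotone A) :
    IsMaximallyMonotone (PrimalDual.inv A) := by
  refine isMaximallyMonotone_of_forall (fun x y u v hu hv => ?_) fun x u h => ?_
  · rw [real_inner_comm]; exact hA.1 _ _ _ _ hu hv
  · refine hA.mem fun y v hv => ?_
    rw [real_inner_comm]; exact h v y hv

/-- A point off the graph of a maximally monotone operator is separated from it by a point of the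
graph. -/
theorem IsMaximallyMonotone.exists_inner_nonpos {A : H → Set H} (hA : IsMaximallyMonotone A)
    (x u : H) : ∃ y v, v ∈ A y ∧ ⟪x - y, u - v⟫_ℝ ≤ 0 ∧ (0 ≤ ⟪x - y, u - v⟫_ℝ → u ∈ A x) := by
  by_cases hu : u ∈ A x
  · exact ⟨x, u, hu, by simp, fun _ => hu⟩
  · have : ¬ ∀ y v, v ∈ A y → 0 ≤ ⟪x - y, u - v⟫_ℝ := fun h => hu (hA.mem h)
    push Not at this
    obtain ⟨y, v, hv, h⟩ := this
    exact ⟨y, v, hv, h.le, fun h' => absurd h h'.not_gt⟩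

theorem mem_resolvent_linComp {U : H →L[ℝ] H} {A : H → Set H} {p w : H} :
    p ∈ resolvent (linComp U A) w ↔ ∃ u ∈ A p, p + U u = w := by
  simp only [resolvent, linComp, PrimalDual.inv, Set.mem_ofPred_eq, Set.singleton_add,
    Set.image_image, Set.mem_image]

theorem mem_resolvent_linComp_iff {U T : H →L[ℝ] H} (hUT : ∀ x, U (T x) = x)
    (hTU : ∀ x, T (U x) = x) {A : H → Set H} {p w : H} :
    p ∈ resolvent (linComp U A) w ↔ T (w - p) ∈ A p := by
  rw [mem_resolvent_linComp]
  constructor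
  · rintro ⟨u, hu, rfl⟩
    rwa [add_sub_cancel_left, hTU]
  · intro h
    exact ⟨_, h, by rw [hUT, add_sub_cancel]⟩

variable [CompleteSpace H]

/-- Minty's theorem at the origin. The Fitzpatrick function dominates the duality pairing, so adding
half the squared norm gives a nonnegative function; the optimality condition at its minimiser
produces the point. -/
theorem IsMaximallyMonotone.exists_neg_mem {A : H → Set H} (hA : IsMaximallyMonotone A) :
    ∃ x, -x ∈ A x := by
  -- The epigraph of the Fitzpatrick function of `A`: closed and convex as an intersection of
  -- half-spaces.
  let E : Set (WithLp 2 (H × H) × ℝ) :=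
    {p | ∀ y v, v ∈ A y → ⟪p.1.fst, v⟫_ℝ + ⟪y, p.1.snd⟫_ℝ - ⟪y, v⟫_ℝ ≤ p.2}
  have hclosed : IsClosed E := by
    have : E = ⋂ (y) (v) (_ : v ∈ A y),
        {p | ⟪p.1.fst, v⟫_ℝ + ⟪y, p.1.snd⟫_ℝ - ⟪y, v⟫_ℝ ≤ p.2} := by
      ext p; simp [E]
    rw [this]
    refine isClosed_iInter fun y => isClosed_iInter fun v => isClosed_iInter fun _ => ?_
    have h1 := WithLp.continuous_fst 2 H H
    have h2 := WithLp.continuous_snd 2 H H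
    exact isClosed_le (by fun_prop) (by fun_prop)
  have hconv : Convex ℝ E := by
    rintro p hp q hq s t hs ht hst y v hv
    have h1 := mul_le_mul_of_nonneg_left (hp y v hv) hs
    have h2 := mul_le_mul_of_nonneg_left (hq y v hv) ht
    simp only [Prod.fst_add, Prod.smul_fst, WithLp.add_fst, WithLp.smul_fst, WithLp.add_snd,
      WithLp.smul_snd, Prod.snd_add, Prod.smul_snd, smul_eq_mul, inner_add_left, inner_add_right,
      real_inner_smul_left, real_inner_smul_right]
    have : ⟪y, v⟫_ℝ = s * ⟪y, v⟫_ℝ + t * ⟪y, v⟫_ℝ := by rw [← add_mul, hst, one_mul]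
    linarith
  have hgraph : ∀ y v, v ∈ A y → (WithLp.toLp 2 (y, v), ⟪y, v⟫_ℝ) ∈ E := by
    intro y v hv y' v' hv'
    have := hA.1 _ _ _ _ hv hv'
    simp only [inner_sub_left, inner_sub_right] at this
    simp only [WithLp.toLp_fst, WithLp.toLp_snd]
    linarith
  -- If this failed, the point would be monotonically related to the whole graph, hence in the graph
  -- by maximality, and testing it against itself would give the inequality.
  have hlow : ∀ p ∈ E, ⟪p.1.fst, p.1.snd⟫_ℝ ≤ p.2 := by
    intro p hp
    by_contra! hlt
    refine (hp p.1.fst p.1.snd (hA.mem fun y v hv => ?_)).not_gt (by linarith)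
    have := hp y v hv
    simp only [inner_sub_left, inner_sub_right]
    linarith
  have hne : E.Nonempty := by
    obtain ⟨y, v, hv, -⟩ := hA.exists_inner_nonpos 0 0
    exact ⟨_, hgraph y v hv⟩
  obtain ⟨⟨p, t⟩, hpE, hmin⟩ := exists_minimiser_add_norm_sq hclosed hconv hne fun p hp => by
    have h1 := hlow p hp
    have h2 := sq_nonneg ‖p.1.fst + p.1.snd‖
    rw [norm_add_sq_real] at h2
    rw [WithLp.prod_norm_sq_eq_of_L2]
    linarith
  have hfo : ∀ y v, v ∈ A y → 0 ≤ ⟪y, v⟫_ℝ - t +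
      (⟪p.fst, y - p.fst⟫_ℝ + ⟪p.snd, v - p.snd⟫_ℝ) := fun y v hv => by
    simpa [WithLp.prod_inner_apply] using first_order_of_minimiser hconv hpE hmin (hgraph y v hv)
  have hlt := hlow _ hpE
  simp only at hlt
  -- This puts `(-p.snd, -p.fst)` in the graph by maximality; taking it as `(y, v)` then forces
  -- `p.fst + p.snd = 0`.
  have hkey : ∀ y v, v ∈ A y → ‖p.fst + p.snd‖ ^ 2 ≤ ⟪-p.snd - y, -p.fst - v⟫_ℝ := fun y v hv => by
    have := hfo y v hv
    rw [norm_add_sq_real]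
    simp only [inner_sub_left, inner_sub_right, inner_neg_left, inner_neg_right,
      real_inner_self_eq_norm_sq] at this ⊢
    rw [real_inner_comm p.fst p.snd, real_inner_comm p.fst y]
    linarith
  have hmem : -p.fst ∈ A (-p.snd) := hA.mem fun y v hv => (sq_nonneg _).trans (hkey y v hv)
  have h0 := hkey _ _ hmem
  simp only [sub_self, inner_zero_left] at h0
  have h1 : p.fst + p.snd = 0 := by
    rw [← norm_eq_zero]; exact pow_eq_zero_iff two_ne_zero |>.1 (le_antisymm h0 (sq_nonneg _))
  refine ⟨-p.snd, ?_⟩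
  rw [neg_neg, ← neg_eq_of_add_eq_zero_right h1]
  rwa [neg_eq_of_add_eq_zero_right h1] at hmem ⊢

/-- **Minty's theorem**: `Id + A` is surjective. -/
theorem IsMaximallyMonotone.exists_sub_mem {A : H → Set H} (hA : IsMaximallyMonotone A) (w : H) :
    ∃ x, w - x ∈ A x := by
  have hA' : IsMaximallyMonotone fun x => {u | u + w ∈ A x} := by
    refine isMaximallyMonotone_of_forall (fun x y u v hu hv => ?_) fun x u h => ?_
    · simpa using hA.1 _ _ _ _ hu hv
    · refine hA.mem fun y v hv => ?_
      have := h y (v - w) (by simpa using hv)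
      rwa [← sub_add, sub_add_eq_add_sub] at this
  obtain ⟨x, hx⟩ := hA'.exists_neg_mem
  exact ⟨x, by simpa [neg_add_eq_sub] using hx⟩

/-- Conjugation by the square root `S` of `U` turns `U A` into the maximally monotone operator `S A
S`, to which Minty's theorem applies. Two solutions differ by `-U` applied to the difference of
their values in `A`, so monotonicity and coercivity of `U` make them equal. -/
theorem existsUnique_mem_resolvent {α : ℝ} (hα : 0 < α) {U : H →L[ℝ] H}
    (hU : U ∈ coerciveOps α H) {A : H → Set H} (hA : IsMaximallyMonotone A) (w : H) :
    ∃! p, p ∈ resolvent (linComp U A) w := by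
  obtain ⟨hS, hSS⟩ := opSqrt_spec hα hU
  obtain ⟨s, hs⟩ := isUnit_opSqrt hα hU
  set S := opSqrt U
  set R : H →L[ℝ] H := ↑s⁻¹
  have hSR : ∀ x, S (R x) = x := fun x => by rw [← hs]; exact DFunLike.congr_fun s.mul_inv x
  have hRS : ∀ x, R (S x) = x := fun x => by rw [← hs]; exact DFunLike.congr_fun s.inv_mul x
  have hRsa := inverse_isSelfAdjoint hS.isSelfAdjoint hSR
  have hA' : IsMaximallyMonotone fun q => {t | R t ∈ A (S q)} := by
    have hin : ∀ q q' t t', ⟪q - q', t - t'⟫_ℝ = ⟪S q - S q', R t - R t'⟫_ℝ := by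
      intro q q' t t'
      rw [← map_sub, ← map_sub, inner_map_comm hS.isSelfAdjoint, hSR]
    refine isMaximallyMonotone_of_forall (fun x y u v hu hv => ?_) fun x u h => ?_
    · rw [hin]; exact hA.1 _ _ _ _ hu hv
    · refine hA.mem fun y v hv => ?_
      have := h (R y) (S v) (by simpa [hSR, hRS] using hv)
      rwa [hin, hSR, hRS] at this
  obtain ⟨q, hq⟩ := hA'.exists_sub_mem (R w)
  refine ⟨S q, mem_resolvent_linComp.2 ⟨_, hq, ?_⟩, fun p' hp' => ?_⟩
  · rw [← hSS, hSR, map_sub, hSR, add_sub_cancel]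
  · obtain ⟨u', hu', e'⟩ := mem_resolvent_linComp.1 hp'
    have h1 := hA.1 _ _ _ _ hu' hq
    have e : p' - S q = - U (u' - R (R w - q)) := by
      rw [map_sub, ← hSS (R (R w - q)), hSR, map_sub, hSR, ← e']
      abel
    rw [e, inner_neg_left] at h1
    have h2 := le_inner_of_mem_coerciveOps hU (u' - R (R w - q))
    have h3 : ‖u' - R (R w - q)‖ ^ 2 ≤ 0 := by
      refine nonpos_of_mul_nonpos_right ?_ hα
      linarith
    have h4 : u' - R (R w - q) = 0 := by
      rw [← norm_eq_zero]; exact pow_eq_zero_iff two_ne_zero |>.1 (le_antisymm h3 (sq_nonneg _))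
    rwa [h4, map_zero, neg_zero, sub_eq_zero] at e

/-- The inverse of a maximally monotone `ν`-strongly monotone operator is a `ν`-cocoercive map
defined everywhere. -/
theorem exists_inv_eq_of_stronglyMonotone {ν : ℝ} (hν : 0 < ν) {D : H → Set H}
    (hD : IsMaximallyMonotone D) (hDν : IsStronglyMonotone ν D) :
    ∃ E : H → H, (∀ v w, w ∈ PrimalDual.inv D v ↔ w = E v) ∧ IsCocoercive ν E := by
  have hin : ∀ w w' u v' : H, ⟪w - w', ν • (u + w) - v'⟫_ℝ =
      ν * (⟪w - w', u - (ν⁻¹ • v' - w')⟫_ℝ + ‖w - w'‖ ^ 2) := by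
    intro w w' u v'
    have : ν • (u + w) - v' = ν • ((u - (ν⁻¹ • v' - w')) + (w - w')) := by
      have e : u - (ν⁻¹ • v' - w') + (w - w') = u + w - ν⁻¹ • v' := by abel
      rw [e, smul_sub ν (u + w), smul_smul, mul_inv_cancel₀ hν.ne', one_smul]
    rw [this, real_inner_smul_right, inner_add_right, real_inner_self_eq_norm_sq]
  -- This operator is `ν⁻¹ D - Id`; Minty's theorem for it says that `D` is surjective.
  have hD' : IsMaximallyMonotone fun w => {u | ν • (u + w) ∈ D w} := by
    refine isMaximallyMonotone_of_forall (fun x y u v hu hv => ?_) fun x u h => ?_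
    · have h1 := hDν _ _ _ _ hu hv
      rw [hin, smul_smul, inv_mul_cancel₀ hν.ne', one_smul, add_sub_cancel_right, mul_add] at h1
      refine nonneg_of_mul_nonneg_right (a := ν) ?_ hν
      linarith
    · refine hD.mem fun y v hv => ?_
      have h1 := h y (ν⁻¹ • v - y) (by
        rwa [Set.mem_ofPred_eq, sub_add_cancel, smul_smul, mul_inv_cancel₀ hν.ne', one_smul])
      rw [hin]
      positivity
  have hex : ∀ v, ∃ w, v ∈ D w := fun v => by
    obtain ⟨w, hw⟩ := hD'.exists_sub_mem (ν⁻¹ • v)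
    rw [Set.mem_ofPred_eq, sub_add_cancel, smul_smul, mul_inv_cancel₀ hν.ne', one_smul] at hw
    exact ⟨w, hw⟩
  choose E hE using hex
  refine ⟨E, fun v w => ⟨fun h => ?_, ?_⟩, fun v v' => ?_⟩
  · have h1 := hDν _ _ _ _ h (hE v)
    rw [sub_self, inner_zero_right] at h1
    have h2 : ‖w - E v‖ ^ 2 ≤ 0 := nonpos_of_mul_nonpos_right h1 hν
    rw [← sub_eq_zero, ← norm_eq_zero]
    exact pow_eq_zero_iff two_ne_zero |>.1 (le_antisymm h2 (sq_nonneg _))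
  · rintro rfl; exact hE v
  · rw [real_inner_comm]; exact hDν _ _ _ _ (hE v) (hE v')

end Monotone

/-! ### Real sequences and quadratic forms for the Fejér argument -/

section Fejer

/-- Subtracting the partial sums of `η` gives a decreasing sequence that is bounded below. -/
theorem exists_tendsto_of_le_add_summable {φ η : ℕ → ℝ} (hφ : ∀ n, 0 ≤ φ n) (hη : ∀ n, 0 ≤ η n)
    (hs : Summable η) (h : ∀ n, φ (n + 1) ≤ φ n + η n) : ∃ l, Tendsto φ atTop (𝓝 l) := by
  have hanti : Antitone fun n => φ n - ∑ k ∈ Finset.range n, η k :=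
    antitone_nat_of_succ_le fun n => by
      rw [Finset.sum_range_succ]
      linarith [h n]
  have hb : BddBelow (Set.range fun n => φ n - ∑ k ∈ Finset.range n, η k) := by
    refine ⟨-∑' k, η k, ?_⟩
    rintro _ ⟨n, rfl⟩
    have := hs.sum_le_tsum (Finset.range n) fun k _ => hη k
    linarith [hφ n]
  exact ⟨_, by simpa using (tendsto_atTop_ciInf hanti hb).add hs.hasSum.tendsto_sum_nat⟩

theorem exists_pos_le_quadratic {a b : ℝ} (ha : 0 < a) (hb : 0 < b) (hab : 1 < a * b) :
    ∃ c > 0, ∀ x y : ℝ, c * (x ^ 2 + y ^ 2) ≤ a * x ^ 2 - 2 * (x * y) + b * y ^ 2 := by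
  -- Determinant over trace of the form, a lower bound for its smallest eigenvalue; it satisfies `(a
  -- - c)(b - c) = 1 + c²`, which allows completing the square.
  refine ⟨(a * b - 1) / (a + b), by have := sub_pos.2 hab; positivity, fun x y => ?_⟩
  set c := (a * b - 1) / (a + b) with hc
  have h1 : c * (a + b) = a * b - 1 := div_mul_cancel₀ _ (by positivity)
  have h2 : 0 < a - c := by
    rw [sub_pos, hc, div_lt_iff₀ (by positivity)]
    nlinarith
  have h3 : (a - c) * (b - c) = 1 + c ^ 2 := by linear_combination -h1
  have h4 : 0 ≤ (a - c) * ((a - c) * x ^ 2 - 2 * (x * y) + (b - c) * y ^ 2) := by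
    have : (a - c) * ((a - c) * x ^ 2 - 2 * (x * y) + (b - c) * y ^ 2) =
      ((a - c) * x - y) ^ 2 + c ^ 2 * y ^ 2 := by linear_combination y ^ 2 * h3
    rw [this]
    positivity
  have := nonneg_of_mul_nonneg_right h4 h2
  linarith

end Fejer

/-! ### The variable metric forward-backward algorithm -/

section ForwardBackward

variable {K : Type*} [NormedAddCommGroup K] [InnerProductSpace ℝ K]

/-- The one-step Fejér estimate: `Δ` is the displacement from a zero, `D` the residual and `q` the
variation of the cocoercive part. Monotonicity and cocoercivity bound the decrease below by a
quadratic form in `‖D‖` and `‖q‖`, which `hc` makes positive definite when `c > 0`. -/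
theorem norm_sub_smul_descent {W : K →L[ℝ] K} (hW : ∀ x y, ⟪W x, y⟫_ℝ = ⟪x, W y⟫_ℝ)
    {β σ c lam : ℝ} (hlam : 0 ≤ lam)
    (hc : ∀ x y : ℝ, c * (x ^ 2 + y ^ 2) ≤
      (1 / (2 * β) + σ) * x ^ 2 - 2 * (x * y) + 2 * β * y ^ 2)
    {Δ D q : K} (hσ : (1 / (2 * β) + σ) * ‖D‖ ^ 2 ≤ (2 - lam) * ⟪W D, D⟫_ℝ)
    (hmon : 0 ≤ ⟪Δ - D, W D - q⟫_ℝ) (hco : β * ‖q‖ ^ 2 ≤ ⟪Δ, q⟫_ℝ) :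
    ⟪W (Δ - lam • D), Δ - lam • D⟫_ℝ + lam * (c * (‖D‖ ^ 2 + ‖q‖ ^ 2)) ≤ ⟪W Δ, Δ⟫_ℝ := by
  have h1 := hc ‖D‖ ‖q‖
  have h2 := real_inner_le_norm D q
  have h3 : ⟪W Δ, D⟫_ℝ = ⟪Δ, W D⟫_ℝ := hW _ _
  have h4 : ⟪W D, Δ⟫_ℝ = ⟪Δ, W D⟫_ℝ := real_inner_comm _ _
  have h5 : ⟪D, W D⟫_ℝ = ⟪W D, D⟫_ℝ := real_inner_comm _ _
  simp only [map_sub, map_smul, inner_sub_left, inner_sub_right, real_inner_smul_left,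
    real_inner_smul_right, h3, h4, h5] at hmon ⊢
  have h6 : c * (‖D‖ ^ 2 + ‖q‖ ^ 2) ≤ 2 * ⟪Δ, W D⟫_ℝ - lam * ⟪W D, D⟫_ℝ := by linarith
  nlinarith [mul_le_mul_of_nonneg_left h6 hlam]

/-- A decreasing sequence of positive operators converges pointwise. -/
theorem exists_tendsto_apply_of_antitone [CompleteSpace K] {W : ℕ → K →L[ℝ] K}
    (hsym : ∀ n x y, ⟪W n x, y⟫_ℝ = ⟪x, W n y⟫_ℝ) (hpos : ∀ n x, 0 ≤ ⟪W n x, x⟫_ℝ)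
    (hanti : ∀ x, Antitone fun n => ⟪W n x, x⟫_ℝ) (x : K) :
    ∃ g, Tendsto (fun n => W n x) atTop (𝓝 g) := by
  set M := ‖W 0‖ + 1 with hM
  have hM0 : 0 < M := by positivity
  have hb : BddBelow (Set.range fun n => ⟪W n x, x⟫_ℝ) := ⟨0, by rintro _ ⟨n, rfl⟩; exact hpos n x⟩
  have hlim := tendsto_atTop_ciInf (hanti x) hb
  set m := ⨅ n, ⟪W n x, x⟫_ℝ
  -- `W N - W n` is positive with form at most `M ‖·‖²`, so convergence of the quadratic forms
  -- controls the vectors themselves.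
  have hdist : ∀ N n, N ≤ n → ‖W N x - W n x‖ ^ 2 ≤ M * (⟪W N x, x⟫_ℝ - m) := by
    intro N n hNn
    have h := norm_map_sq_le_of_inner_le (W := W N - W n) hM0
      (fun x y => by simp [inner_sub_left, inner_sub_right, hsym])
      (fun y => by simpa [inner_sub_left] using hanti y hNn)
      (fun y => ?_) x
    · rw [sub_apply, inner_sub_left] at h
      exact h.trans (by gcongr; exact ciInf_le hb n)
    · calc _ = ⟪W N y, y⟫_ℝ - ⟪W n y, y⟫_ℝ := by rw [sub_apply, inner_sub_left]
        _ ≤ ⟪W 0 y, y⟫_ℝ := by linarith [hanti y (Nat.zero_le N), hpos n y]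
        _ ≤ ‖W 0 y‖ * ‖y‖ := real_inner_le_norm _ _
        _ ≤ (M * ‖y‖) * ‖y‖ := by
          gcongr
          exact (W 0).le_of_opNorm_le (by linarith) y
        _ = _ := by ring
  have hcau : CauchySeq fun n => W n x := by
    refine cauchySeq_of_le_tendsto_0' (fun N => √(M * (⟪W N x, x⟫_ℝ - m))) ?_ ?_
    · intro N n hNn
      rw [dist_eq_norm]
      exact Real.le_sqrt_of_sq_le (hdist N n hNn)
    · have := ((hlim.sub_const m).const_mul M).sqrt
      simpa using this
  exact cauchySeq_tendsto_of_complete hcau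

/-- A run `w` of the variable metric forward-backward algorithm for the inclusion
`0 ∈ A z + S z + Q z`. The point `v n` is the exact forward-backward step from `w n` in the metric
`W n`, and `v' n + f n` is the step that is computed. -/
structure IsForwardBackward (A : K → Set K) (S : K →L[ℝ] K) (Q : K → K) (W : ℕ → K →L[ℝ] K)
    (lam : ℕ → ℝ) (w v v' e f : ℕ → K) (β ρ σ ε : ℝ) : Prop where
  maximal : IsMaximallyMonotone A
  skew : ∀ x, ⟪x, S x⟫_ℝ = 0
  cocoercive : IsCocoercive β Q
  beta_pos : 0 < β
  rho_pos : 0 < ρ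
  sigma_pos : 0 < σ
  eps_pos : 0 < ε
  symm : ∀ n x y, ⟪W n x, y⟫_ℝ = ⟪x, W n y⟫_ℝ
  coercive : ∀ n x, ρ * ‖x‖ ^ 2 ≤ ⟪W n x, x⟫_ℝ
  succ_le : ∀ n x, ⟪W (n + 1) x, x⟫_ℝ ≤ ⟪W n x, x⟫_ℝ
  -- The constant `1 / (2 * β)` is what the forward step consumes; `σ` is the slack that makes the
  -- descent strict.
  relax : ∀ n x, (1 / (2 * β) + σ) * ‖x‖ ^ 2 ≤ (2 - lam n) * ⟪W n x, x⟫_ℝ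
  le_lam : ∀ n, ε ≤ lam n
  lam_le : ∀ n, lam n ≤ 2
  summable_e : Summable fun n => ‖e n‖
  summable_f : Summable fun n => ‖f n‖
  exact_step : ∀ n, W n (w n - v n) - S (v n) - Q (w n) ∈ A (v n)
  inexact_step : ∀ n, W n (w n - v' n) - S (v' n) - Q (w n) - e n ∈ A (v' n)
  update : ∀ n, w (n + 1) = w n + lam n • (v' n + f n - w n)

namespace IsForwardBackward

variable {A : K → Set K} {S : K →L[ℝ] K} {Q : K → K} {W : ℕ → K →L[ℝ] K}
    {lam : ℕ → ℝ} {w v v' e f : ℕ → K} {β ρ σ ε : ℝ}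

theorem pos (h : IsForwardBackward A S Q W lam w v v' e f β ρ σ ε) (n : ℕ) (x : K) :
    0 ≤ ⟪W n x, x⟫_ℝ :=
  (mul_nonneg h.rho_pos.le (sq_nonneg _)).trans (h.coercive n x)

theorem antitone (h : IsForwardBackward A S Q W lam w v v' e f β ρ σ ε) (x : K) :
    Antitone fun n => ⟪W n x, x⟫_ℝ := antitone_nat_of_succ_le fun n => h.succ_le n x

theorem inner_le (h : IsForwardBackward A S Q W lam w v v' e f β ρ σ ε) (n : ℕ) (x : K) :
    ⟪W n x, x⟫_ℝ ≤ (‖W 0‖ + 1) * ‖x‖ ^ 2 :=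
  calc _ ≤ ⟪W 0 x, x⟫_ℝ := h.antitone x (Nat.zero_le n)
    _ ≤ ‖W 0 x‖ * ‖x‖ := real_inner_le_norm _ _
    _ ≤ ((‖W 0‖ + 1) * ‖x‖) * ‖x‖ := by
      gcongr
      exact (W 0).le_of_opNorm_le (by linarith) x
    _ = _ := by ring

/-- Monotonicity of `A` between the two steps bounds the metric form of their difference by its
pairing with `e n`, because the skew part drops out. -/
theorem norm_sub_le (h : IsForwardBackward A S Q W lam w v v' e f β ρ σ ε) (n : ℕ) :
    ‖v n - v' n‖ ≤ ‖e n‖ / ρ := by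
  have h1 := h.maximal.1 _ _ _ _ (h.exact_step n) (h.inexact_step n)
  have h2 : W n (w n - v n) - S (v n) - Q (w n) - (W n (w n - v' n) - S (v' n) - Q (w n) - e n) =
      e n - W n (v n - v' n) - S (v n - v' n) := by
    simp only [map_sub]; abel
  rw [h2, inner_sub_right, inner_sub_right, h.skew, sub_zero, real_inner_comm (W n _)] at h1
  have h3 := h.coercive n (v n - v' n)
  have h4 := real_inner_le_norm (v n - v' n) (e n)
  rw [le_div_iff₀ h.rho_pos]
  rcases (norm_nonneg (v n - v' n)).eq_or_lt with h5 | h5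
  · rw [← h5, zero_mul]; exact norm_nonneg _
  · refine le_of_mul_le_mul_left ?_ h5
    nlinarith

theorem inner_nonneg (h : IsForwardBackward A S Q W lam w v v' e f β ρ σ ε) {z : K}
    (hz : -S z - Q z ∈ A z) (n : ℕ) :
    0 ≤ ⟪(w n - z) - (w n - v n), W n (w n - v n) - (Q (w n) - Q z)⟫_ℝ := by
  have h1 := h.maximal.1 _ _ _ _ (h.exact_step n) hz
  have h2 : W n (w n - v n) - S (v n) - Q (w n) - (-S z - Q z) =
      W n (w n - v n) - (Q (w n) - Q z) - S (v n - z) := by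
    simp only [map_sub]; abel
  rw [h2, inner_sub_right _ _ (S _), h.skew, sub_zero] at h1
  rwa [sub_sub_sub_cancel_left]

variable [CompleteSpace K]

theorem mem_coerciveOps (h : IsForwardBackward A S Q W lam w v v' e f β ρ σ ε) (n : ℕ) :
    W n ∈ coerciveOps ρ K := PrimalDual.mem_coerciveOps (h.symm n) (h.coercive n)

/-- With `φ n` the distance to `z` in the metric `W n` and `ψ n` the distance after an exact relaxed
step, `φ (n + 1) ≤ ψ n + η n ≤ φ n + η n` with `η` summable. Both sequences have the same limit, so
the gap `φ² - ψ²`, which dominates the two squared quantities of the conclusion, vanishes. -/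
theorem tendsto_of_zero (h : IsForwardBackward A S Q W lam w v v' e f β ρ σ ε) {z : K}
    (hz : -S z - Q z ∈ A z) :
    (∃ l, Tendsto (fun n => ⟪W n (w n - z), w n - z⟫_ℝ) atTop (𝓝 l)) ∧
      Tendsto (fun n => w n - v n) atTop (𝓝 0) ∧ Tendsto (fun n => Q (w n)) atTop (𝓝 (Q z)) := by
  have hβ := h.beta_pos
  have hρ := h.rho_pos
  have hε := h.eps_pos
  have hσ := h.sigma_pos
  -- Square roots write the metric as a genuine norm, so that errors enter through the triangle
  -- inequality.
  set R : ℕ → K →L[ℝ] K := fun n => opSqrt (W n) with hR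
  have hRn : ∀ n x, ‖R n x‖ ^ 2 = ⟪W n x, x⟫_ℝ := fun n x =>
    opSqrt_inner h.rho_pos (h.mem_coerciveOps n) x
  set κ := √(‖W 0‖ + 1) with hκ
  have hRle : ∀ n x, ‖R n x‖ ≤ κ * ‖x‖ := fun n x => by
    refine le_of_sq_le_sq ?_ (by positivity)
    rw [hRn, mul_pow, hκ, Real.sq_sqrt (by positivity)]
    exact h.inner_le n x
  obtain ⟨c, hc0, hc⟩ := exists_pos_le_quadratic (a := 1 / (2 * β) + σ) (b := 2 * β)
    (by positivity) (by positivity) (by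
      rw [add_mul, one_div_mul_cancel (by positivity)]
      have : 0 < σ * (2 * β) := by positivity
      linarith)
  set φ : ℕ → ℝ := fun n => ‖R n (w n - z)‖ with hφ
  set ψ : ℕ → ℝ := fun n => ‖R n (w n - z - lam n • (w n - v n))‖ with hψ
  -- The factor `2` bounds `lam n`, `κ` bounds all `R n`, and `‖e n‖ / ρ` bounds the distance
  -- between exact and inexact steps.
  set η : ℕ → ℝ := fun n => 2 * (κ * (‖e n‖ / ρ + ‖f n‖)) with hη
  have hη0 : ∀ n, 0 ≤ η n := fun n => by positivity
  have hηs : Summable η := (((h.summable_e.div_const ρ).add h.summable_f).mul_left κ).mul_left 2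
  have hlam0 : ∀ n, 0 ≤ lam n := fun n => h.eps_pos.le.trans (h.le_lam n)
  have hdesc : ∀ n, ψ n ^ 2 + ε * (c * (‖w n - v n‖ ^ 2 + ‖Q (w n) - Q z‖ ^ 2)) ≤ φ n ^ 2 := by
    intro n
    have := norm_sub_smul_descent (h.symm n) (hlam0 n) hc (h.relax n _) (h.inner_nonneg hz n)
      (h.cocoercive (w n) z)
    simp only [hφ, hψ, hRn]
    refine le_trans ?_ this
    gcongr
    exact h.le_lam n
  have hψφ : ∀ n, ψ n ≤ φ n := fun n => by
    refine le_of_sq_le_sq (le_trans (le_add_of_nonneg_right ?_) (hdesc n)) (norm_nonneg _)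
    positivity
  have hφψ : ∀ n, φ (n + 1) ≤ ψ n + η n := by
    intro n
    have h1 : φ (n + 1) ≤ ‖R n (w (n + 1) - z)‖ := by
      refine le_of_sq_le_sq ?_ (norm_nonneg _)
      simp only [hφ, hRn]
      exact h.succ_le n _
    have h2 : w (n + 1) - z = (w n - z - lam n • (w n - v n)) + lam n • (f n - (v n - v' n)) := by
      rw [h.update]
      simp only [smul_sub, smul_add]; abel
    refine h1.trans ?_
    rw [h2, map_add, map_smul]
    refine (norm_add_le _ _).trans (add_le_add le_rfl ?_)
    rw [norm_smul, Real.norm_of_nonneg (hlam0 n)]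
    have h3 : ‖R n (f n - (v n - v' n))‖ ≤ κ * (‖e n‖ / ρ + ‖f n‖) := by
      refine (hRle n _).trans ?_
      gcongr
      refine (_root_.norm_sub_le _ _).trans ?_
      linarith [h.norm_sub_le n]
    exact mul_le_mul (h.lam_le n) h3 (norm_nonneg _) two_pos.le
  obtain ⟨l, hl⟩ := exists_tendsto_of_le_add_summable (φ := φ) (fun n => norm_nonneg _) hη0 hηs
    (fun n => (hφψ n).trans (add_le_add (hψφ n) le_rfl))
  have hψl : Tendsto ψ atTop (𝓝 l) := by
    refine tendsto_of_tendsto_of_tendsto_of_le_of_le (g := fun n => φ (n + 1) - η n) ?_ hl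
      (fun n => by linarith [hφψ n]) hψφ
    simpa using (hl.comp (tendsto_add_atTop_nat 1)).sub hηs.tendsto_atTop_zero
  have hdiff : Tendsto (fun n => (φ n ^ 2 - ψ n ^ 2) / (ε * c)) atTop (𝓝 0) := by
    simpa using ((hl.pow 2).sub (hψl.pow 2)).div_const (ε * c)
  have hbound : ∀ n, ‖w n - v n‖ ^ 2 + ‖Q (w n) - Q z‖ ^ 2 ≤ (φ n ^ 2 - ψ n ^ 2) / (ε * c) := by
    intro n
    rw [le_div_iff₀ (by positivity)]
    linarith [hdesc n]
  have hsq : ∀ {x : ℕ → K}, (∀ n, ‖x n‖ ^ 2 ≤ (φ n ^ 2 - ψ n ^ 2) / (ε * c)) →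
      Tendsto x atTop (𝓝 0) := by
    intro x hx
    refine squeeze_zero_norm (fun n => Real.le_sqrt_of_sq_le (hx n)) ?_
    simpa using hdiff.sqrt
  refine ⟨⟨l ^ 2, ?_⟩, hsq fun n => ?_, ?_⟩
  · simpa only [hφ, hRn] using hl.pow 2
  · exact (le_add_of_nonneg_right (sq_nonneg _)).trans (hbound n)
  · rw [tendsto_iff_norm_sub_tendsto_zero]
    refine tendsto_zero_iff_norm_tendsto_zero.1 (hsq fun n => ?_)
    exact (le_add_of_nonneg_left (sq_nonneg _)).trans (hbound n)

theorem exists_bound (h : IsForwardBackward A S Q W lam w v v' e f β ρ σ ε) {z : K}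
    (hz : -S z - Q z ∈ A z) : ∃ R, ∀ n, ‖w n‖ ≤ R := by
  obtain ⟨⟨l, hl⟩, -⟩ := h.tendsto_of_zero hz
  obtain ⟨B, hB⟩ := hl.bddAbove_range
  refine ⟨√(B / ρ) + ‖z‖, fun n => ?_⟩
  have h1 : ‖w n - z‖ ≤ √(B / ρ) := by
    refine Real.le_sqrt_of_sq_le ?_
    rw [le_div_iff₀ h.rho_pos, mul_comm]
    exact (h.coercive n _).trans (hB ⟨n, rfl⟩)
  calc ‖w n‖ = ‖(w n - z) + z‖ := by rw [sub_add_cancel]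
    _ ≤ _ := (norm_add_le _ _).trans (add_le_add h1 le_rfl)

/-- Pass to the limit in cocoercivity between `w n` and `l`: the values of `Q` converge strongly and
`w n - l` tends weakly to `0`. -/
theorem map_eq_of_weak_limit (h : IsForwardBackward A S Q W lam w v v' e f β ρ σ ε) {z : K}
    (hz : -S z - Q z ∈ A z) {F : Filter ℕ} [F.NeBot] (hF : F ≤ atTop) {l : K}
    (hl : ∀ x, Tendsto (fun n => ⟪w n, x⟫_ℝ) F (𝓝 ⟪l, x⟫_ℝ)) : Q l = Q z := by
  obtain ⟨R, hR⟩ := h.exists_bound hz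
  have hQ := (h.tendsto_of_zero hz).2.2.mono_left hF
  have h1 : Tendsto (fun n => β * ‖Q (w n) - Q l‖ ^ 2) F (𝓝 (β * ‖Q z - Q l‖ ^ 2)) :=
    (((hQ.sub_const _).norm).pow 2).const_mul β
  have h2 : Tendsto (fun n => ⟪w n - l, Q (w n) - Q l⟫_ℝ) F (𝓝 ⟪l - l, Q z - Q l⟫_ℝ) := by
    simp only [inner_sub_left _ l]
    exact (tendsto_inner_of_weak_of_strong hR hl (hQ.sub_const _)).sub
      (tendsto_const_nhds.inner (hQ.sub_const _))
  have h3 := le_of_tendsto_of_tendsto' h1 h2 fun n => h.cocoercive (w n) l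
  rw [sub_self, inner_zero_left] at h3
  have h4 : ‖Q z - Q l‖ ^ 2 ≤ 0 := nonpos_of_mul_nonpos_right h3 h.beta_pos
  have h5 : ‖Q z - Q l‖ = 0 := pow_eq_zero_iff two_ne_zero |>.1 (le_antisymm h4 (sq_nonneg _))
  exact (sub_eq_zero.1 (norm_eq_zero.1 h5)).symm

/-- The exact steps `v n` share the weak limit `l`, and the non-skew part of their values converges
strongly, so monotonicity against any point of the graph passes to the limit and maximality
concludes. -/
theorem zero_of_weak_limit (h : IsForwardBackward A S Q W lam w v v' e f β ρ σ ε) {z : K}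
    (hz : -S z - Q z ∈ A z) {F : Filter ℕ} [F.NeBot] (hF : F ≤ atTop) {l : K}
    (hl : ∀ x, Tendsto (fun n => ⟪w n, x⟫_ℝ) F (𝓝 ⟪l, x⟫_ℝ)) : -S l - Q l ∈ A l := by
  rw [h.map_eq_of_weak_limit hz hF hl]
  obtain ⟨R, hR⟩ := h.exists_bound hz
  obtain ⟨-, hD, hQ⟩ := h.tendsto_of_zero hz
  obtain ⟨R', hR'⟩ := hD.norm.bddAbove_range
  have hvR : ∀ n, ‖v n‖ ≤ R + R' := fun n => by
    calc ‖v n‖ = ‖w n - (w n - v n)‖ := by rw [sub_sub_cancel]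
      _ ≤ _ := (_root_.norm_sub_le _ _).trans (add_le_add (hR n) (hR' ⟨n, rfl⟩))
  have hv : ∀ x, Tendsto (fun n => ⟪v n, x⟫_ℝ) F (𝓝 ⟪l, x⟫_ℝ) := fun x => by
    have h1 := (hl x).sub ((hD.mono_left hF).inner (tendsto_const_nhds (x := x)))
    simpa [inner_sub_left] using h1
  have hWD : Tendsto (fun n => W n (w n - v n)) atTop (𝓝 0) := by
    have hM : 0 < ‖W 0‖ + 1 := by positivity
    refine squeeze_zero_norm (a := fun n => (‖W 0‖ + 1) * ‖w n - v n‖) (fun n => ?_) ?_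
    · refine le_of_sq_le_sq ?_ (by positivity)
      calc _ ≤ (‖W 0‖ + 1) * ⟪W n (w n - v n), w n - v n⟫_ℝ :=
            norm_map_sq_le_of_inner_le hM (h.symm n) (h.pos n) (h.inner_le n) _
        _ ≤ (‖W 0‖ + 1) * ((‖W 0‖ + 1) * ‖w n - v n‖ ^ 2) := by gcongr; exact h.inner_le n _
        _ = _ := by ring
    · simpa using hD.norm.const_mul (‖W 0‖ + 1)
  have hu : Tendsto (fun n => W n (w n - v n) - Q (w n)) F (𝓝 (-Q z)) := by
    simpa using (hWD.sub hQ).mono_left hF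
  refine h.maximal.mem fun y s hs => ?_
  have h1 : Tendsto (fun n => ⟪v n, W n (w n - v n) - Q (w n) - s⟫_ℝ
      - ⟪y, W n (w n - v n) - Q (w n) - s⟫_ℝ + ⟪v n, S.adjoint y⟫_ℝ) F
      (𝓝 (⟪l, -Q z - s⟫_ℝ - ⟪y, -Q z - s⟫_ℝ + ⟪l, S.adjoint y⟫_ℝ)) :=
    ((tendsto_inner_of_weak_of_strong hvR hv (hu.sub_const s)).sub
      (tendsto_const_nhds.inner (hu.sub_const s))).add (hv _)
  -- Since `⟪x, S x⟫ = 0`, the skew contribution is linear in `x`, hence weakly continuous.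
  have key : ∀ x u : K, ⟪x - y, u - S x - s⟫_ℝ =
      ⟪x, u - s⟫_ℝ - ⟪y, u - s⟫_ℝ + ⟪x, S.adjoint y⟫_ℝ := fun x u => by
    have e : u - S x - s = (u - s) - S x := by abel
    rw [ContinuousLinearMap.adjoint_inner_right, real_inner_comm y (S x), e, inner_sub_right,
      inner_sub_left x y (S x), inner_sub_left, h.skew]
    ring
  have e : -S l - Q z - s = -Q z - S l - s := by abel
  rw [e, key]
  refine ge_of_tendsto' h1 fun n => ?_
  rw [← key]
  have := h.maximal.1 _ _ _ _ (h.exact_step n) hs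
  rwa [sub_right_comm (W n _)] at this

/-- Opial's argument: in the difference of the squared distances to `l₁` and `l₂` the term quadratic
in `w n` cancels, so `⟪w n, W n (l₁ - l₂)⟫` converges. As `W n (l₁ - l₂)` converges strongly to some
`g`, both weak limits pair equally with `g`, and coercivity gives equality. -/
theorem weak_limit_unique (h : IsForwardBackward A S Q W lam w v v' e f β ρ σ ε) {l₁ l₂ : K}
    (hz₁ : -S l₁ - Q l₁ ∈ A l₁) (hz₂ : -S l₂ - Q l₂ ∈ A l₂) {F₁ F₂ : Filter ℕ} [F₁.NeBot]
    [F₂.NeBot] (hF₁ : F₁ ≤ atTop) (hF₂ : F₂ ≤ atTop)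
    (hl₁ : ∀ x, Tendsto (fun n => ⟪w n, x⟫_ℝ) F₁ (𝓝 ⟪l₁, x⟫_ℝ))
    (hl₂ : ∀ x, Tendsto (fun n => ⟪w n, x⟫_ℝ) F₂ (𝓝 ⟪l₂, x⟫_ℝ)) : l₁ = l₂ := by
  obtain ⟨R, hR⟩ := h.exists_bound hz₁
  obtain ⟨⟨c₁, hc₁⟩, -⟩ := h.tendsto_of_zero hz₁
  obtain ⟨⟨c₂, hc₂⟩, -⟩ := h.tendsto_of_zero hz₂
  have hconv := exists_tendsto_apply_of_antitone h.symm h.pos h.antitone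
  obtain ⟨g₁, hg₁⟩ := hconv l₁
  obtain ⟨g₂, hg₂⟩ := hconv l₂
  obtain ⟨g, hg⟩ := hconv (l₁ - l₂)
  have hlim : ∃ c, Tendsto (fun n => ⟪w n, W n (l₁ - l₂)⟫_ℝ) atTop (𝓝 c) := by
    have h1 := ((((hg₁.inner (tendsto_const_nhds (x := l₁))).sub
      (hg₂.inner (tendsto_const_nhds (x := l₂)))).sub (hc₁.sub hc₂))).div_const 2
    refine ⟨_, h1.congr fun n => ?_⟩
    have e : ∀ x, ⟪W n (w n - x), w n - x⟫_ℝ =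
        ⟪W n (w n), w n⟫_ℝ - 2 * ⟪w n, W n x⟫_ℝ + ⟪W n x, x⟫_ℝ := fun x => by
      rw [map_sub, inner_sub_left, inner_sub_right, inner_sub_right, h.symm n (w n) x,
        real_inner_comm (w n) (W n x)]
      ring
    rw [e, e, map_sub, inner_sub_right]
    ring
  obtain ⟨c, hc⟩ := hlim
  have e₁ := tendsto_nhds_unique (hc.mono_left hF₁)
    (tendsto_inner_of_weak_of_strong hR hl₁ (hg.mono_left hF₁))
  have e₂ := tendsto_nhds_unique (hc.mono_left hF₂)
    (tendsto_inner_of_weak_of_strong hR hl₂ (hg.mono_left hF₂))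
  have h3 : ρ * ‖l₁ - l₂‖ ^ 2 ≤ ⟪g, l₁ - l₂⟫_ℝ :=
    ge_of_tendsto' (hg.inner tendsto_const_nhds) fun n => h.coercive n _
  rw [real_inner_comm, inner_sub_left, ← e₁, ← e₂, sub_self] at h3
  have h4 : ‖l₁ - l₂‖ ^ 2 ≤ 0 := nonpos_of_mul_nonpos_right h3 h.rho_pos
  have h5 : ‖l₁ - l₂‖ = 0 := pow_eq_zero_iff two_ne_zero |>.1 (le_antisymm h4 (sq_nonneg _))
  exact sub_eq_zero.1 (norm_eq_zero.1 h5)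

/-- Convergence of the variable metric forward-backward algorithm. -/
theorem exists_tendsto (h : IsForwardBackward A S Q W lam w v v' e f β ρ σ ε)
    (hz : ∃ z, -S z - Q z ∈ A z) :
    ∃ z, -S z - Q z ∈ A z ∧ (∀ x, Tendsto (fun n => ⟪w n, x⟫_ℝ) atTop (𝓝 ⟪z, x⟫_ℝ)) ∧
      Tendsto (fun n => Q (w n)) atTop (𝓝 (Q z)) := by
  obtain ⟨z₀, hz₀⟩ := hz
  obtain ⟨R, hR⟩ := h.exists_bound hz₀
  obtain ⟨l, hl⟩ := exists_weak_limit (Ultrafilter.of atTop) hR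
  have hzl := h.zero_of_weak_limit hz₀ (Ultrafilter.of_le atTop) hl
  refine ⟨l, hzl, fun x => ?_, (h.tendsto_of_zero hzl).2.2⟩
  rw [tendsto_iff_ultrafilter]
  intro F hF
  obtain ⟨l', hl'⟩ := exists_weak_limit F hR
  have hzl' := h.zero_of_weak_limit hz₀ hF hl'
  rw [h.weak_limit_unique hzl hzl' (Ultrafilter.of_le atTop) hF hl hl']
  exact hl' x

end IsForwardBackward

end ForwardBackward

/-! ### The direct sum, its operators and the metric -/

section Product

/-- The Hilbert direct sum of `H` and the `G i`. -/
abbrev DirectSum {m : ℕ} (H : Type*) (G : Fin m → Type*) : Type _ := WithLp 2 (H × PiLp 2 G)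

/-- The point `(x, v)` of the direct sum. -/
def pair {m : ℕ} {H : Type*} {G : Fin m → Type*} (x : H) (v : ∀ i, G i) : DirectSum H G :=
  WithLp.toLp 2 (x, WithLp.toLp 2 v)

@[simp] theorem pair_fst {m : ℕ} {H : Type*} {G : Fin m → Type*} (x : H) (v : ∀ i, G i) :
    (pair x v).fst = x := rfl

@[simp] theorem pair_snd {m : ℕ} {H : Type*} {G : Fin m → Type*} (x : H) (v : ∀ i, G i)
    (i : Fin m) : (pair x v).snd i = v i := rfl

variable {m : ℕ} {H : Type*} [NormedAddCommGroup H] [InnerProductSpace ℝ H]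
  {G : Fin m → Type*} [∀ i, NormedAddCommGroup (G i)] [∀ i, InnerProductSpace ℝ (G i)]

theorem directSum_inner (k l : DirectSum H G) :
    ⟪k, l⟫_ℝ = ⟪k.fst, l.fst⟫_ℝ + ∑ i, ⟪k.snd i, l.snd i⟫_ℝ := by
  rw [WithLp.prod_inner_apply, ← WithLp.ofLp_fst, ← WithLp.ofLp_fst, ← WithLp.ofLp_snd,
    ← WithLp.ofLp_snd, PiLp.inner_apply]

theorem directSum_norm_sq (k : DirectSum H G) : ‖k‖ ^ 2 = ‖k.fst‖ ^ 2 + ∑ i, ‖k.snd i‖ ^ 2 := by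
  rw [← real_inner_self_eq_norm_sq, directSum_inner]
  simp only [real_inner_self_eq_norm_sq]

theorem norm_pair_le (x : H) (v : ∀ i, G i) : ‖pair x v‖ ≤ ‖x‖ + ∑ i, ‖v i‖ := by
  have h0 : 0 ≤ ∑ i, ‖v i‖ := Finset.sum_nonneg fun _ _ => norm_nonneg _
  refine le_of_sq_le_sq ?_ (by positivity)
  have h1 : ∑ i, ‖v i‖ ^ 2 ≤ (∑ i, ‖v i‖) ^ 2 :=
    Finset.sum_sq_le_sq_sum_of_nonneg fun _ _ => norm_nonneg _
  rw [directSum_norm_sq]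
  simp only [pair_fst, pair_snd]
  nlinarith [norm_nonneg x]

theorem summable_norm_pair {x : ℕ → H} {v : ∀ i, ℕ → G i} (hx : Summable fun n => ‖x n‖)
    (hv : ∀ i, Summable fun n => ‖v i n‖) : Summable fun n => ‖pair (x n) fun i => v i n‖ :=
  .of_nonneg_of_le (fun _ => norm_nonneg _) (fun _ => norm_pair_le _ _)
    (hx.add (summable_sum fun i _ => hv i))

/-- The continuous linear map into the direct sum with given components. -/
noncomputable def pairL {E : Type*} [NormedAddCommGroup E] [InnerProductSpace ℝ E] (f : E →L[ℝ] H)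
    (g : ∀ i, E →L[ℝ] G i) : E →L[ℝ] DirectSum H G :=
  (WithLp.prodContinuousLinearEquiv 2 ℝ H (PiLp 2 G)).symm.toContinuousLinearMap ∘L
    f.prod ((PiLp.continuousLinearEquiv 2 ℝ G).symm.toContinuousLinearMap ∘L ContinuousLinearMap.pi g)

theorem pairL_apply {E : Type*} [NormedAddCommGroup E] [InnerProductSpace ℝ E] (f : E →L[ℝ] H)
    (g : ∀ i, E →L[ℝ] G i) (x : E) : pairL f g x = pair (f x) fun i => g i x := rfl

variable (H G) in
/-- The first projection. -/
noncomputable def fstP : DirectSum H G →L[ℝ] H := WithLp.fstL 2 ℝ H (PiLp 2 G)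

variable (H G) in
/-- The projection on the component `G i`. -/
noncomputable def sndP (i : Fin m) : DirectSum H G →L[ℝ] G i :=
  PiLp.proj 2 G i ∘L WithLp.sndL 2 ℝ H (PiLp 2 G)

theorem fstP_apply (k : DirectSum H G) : fstP H G k = k.fst := rfl

theorem sndP_apply (i : Fin m) (k : DirectSum H G) : sndP H G i k = k.snd i := rfl

/-- The set-valued operator `(x, v) ↦ (A x - z) × ∏ (rᵢ + Bᵢ⁻¹ vᵢ)`. -/
def monoOp (z : H) (A : H → Set H) (B : ∀ i, G i → Set (G i)) (r : ∀ i, G i) :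
    DirectSum H G → Set (DirectSum H G) :=
  fun k => {u | u.fst + z ∈ A k.fst ∧ ∀ i, u.snd i - r i ∈ inv (B i) (k.snd i)}

/-- For maximality, pick in each block a graph point with nonpositive pairing. The sum of the
pairings is nonnegative by assumption, so each one vanishes, which forces membership blockwise. -/
theorem isMaximallyMonotone_monoOp {z : H} {A : H → Set H} {B : ∀ i, G i → Set (G i)}
    {r : ∀ i, G i} (hA : IsMaximallyMonotone A) (hB : ∀ i, IsMaximallyMonotone (B i)) :
    IsMaximallyMonotone (monoOp z A B r) := by
  refine isMaximallyMonotone_of_forall (fun x y u v hu hv => ?_) fun x u h => ?_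
  · rw [directSum_inner]
    refine add_nonneg ?_ (Finset.sum_nonneg fun i _ => ?_)
    · simpa using hA.1 _ _ _ _ hu.1 hv.1
    · simpa using (hB i).inv.1 _ _ _ _ (hu.2 i) (hv.2 i)
  · obtain ⟨y₀, v₀, hv₀, hle₀, hmem₀⟩ := hA.exists_inner_nonpos x.fst (u.fst + z)
    choose y v hv hle hmem using fun i =>
      (hB i).inv.exists_inner_nonpos (x.snd i) (u.snd i - r i)
    have h1 := h (pair y₀ y) (pair (v₀ - z) fun i => v i + r i)
      ⟨by simpa using hv₀, fun i => by simpa using hv i⟩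
    simp only [directSum_inner, WithLp.sub_fst, WithLp.sub_snd, PiLp.sub_apply, pair_fst,
      pair_snd] at h1
    have e₀ : u.fst - (v₀ - z) = u.fst + z - v₀ := by abel
    have e : ∀ i, u.snd i - (v i + r i) = u.snd i - r i - v i := fun i => by abel
    simp only [e₀, e] at h1
    have h2 : ∑ i, ⟪x.snd i - y i, u.snd i - r i - v i⟫_ℝ ≤ 0 :=
      Finset.sum_nonpos fun i _ => hle i
    refine ⟨hmem₀ (by linarith), fun i => hmem i ?_⟩
    have h3 : ∑ i, ⟪x.snd i - y i, u.snd i - r i - v i⟫_ℝ ≤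
        ⟪x.snd i - y i, u.snd i - r i - v i⟫_ℝ := by
      rw [← Finset.add_sum_erase _ _ (Finset.mem_univ i)]
      linarith [Finset.sum_nonpos fun j (_ : j ∈ Finset.univ.erase i) => hle j]
    linarith

/-- The map `(x, v) ↦ (C x, (Eᵢ vᵢ)ᵢ)`. -/
def cocoOp (C : H → H) (E : ∀ i, G i → G i) (k : DirectSum H G) : DirectSum H G :=
  pair (C k.fst) fun i => E i (k.snd i)

theorem isCocoercive_cocoOp {C : H → H} {E : ∀ i, G i → G i} {μ β : ℝ} {ν : Fin m → ℝ}
    (hC : IsCocoercive μ C) (hE : ∀ i, IsCocoercive (ν i) (E i)) (hμ : β ≤ μ)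
    (hν : ∀ i, β ≤ ν i) : IsCocoercive β (cocoOp C E : DirectSum H G → DirectSum H G) := by
  intro k l
  rw [directSum_norm_sq, directSum_inner, mul_add, Finset.mul_sum]
  refine add_le_add ?_ (Finset.sum_le_sum fun i _ => ?_)
  · exact (mul_le_mul_of_nonneg_right hμ (sq_nonneg _)).trans (hC _ _)
  · exact (mul_le_mul_of_nonneg_right (hν i) (sq_nonneg _)).trans (hE i _ _)

variable [CompleteSpace H] [∀ i, CompleteSpace (G i)]

/-- The skew operator `(x, v) ↦ (∑ Lᵢ* vᵢ, (-Lᵢ x)ᵢ)`. -/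
noncomputable def skewOp (L : ∀ i, H →L[ℝ] G i) : DirectSum H G →L[ℝ] DirectSum H G :=
  pairL (∑ i, (L i).adjoint ∘L sndP H G i) fun i => -(L i ∘L fstP H G)

@[simp] theorem skewOp_fst (L : ∀ i, H →L[ℝ] G i) (k : DirectSum H G) :
    (skewOp L k).fst = ∑ i, (L i).adjoint (k.snd i) := by
  simp [skewOp, pairL_apply, sndP_apply]

@[simp] theorem skewOp_snd (L : ∀ i, H →L[ℝ] G i) (k : DirectSum H G) (i : Fin m) :
    (skewOp L k).snd i = -L i k.fst := rfl

theorem inner_skewOp (L : ∀ i, H →L[ℝ] G i) (k : DirectSum H G) : ⟪k, skewOp L k⟫_ℝ = 0 := by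
  rw [directSum_inner]
  simp [inner_sum, ContinuousLinearMap.adjoint_inner_right, real_inner_comm, inner_neg_right]

/-- The metric `(x, v) ↦ (T x - ∑ Lᵢ* vᵢ, (Rᵢ vᵢ - Lᵢ x)ᵢ)`. -/
noncomputable def metricOp (L : ∀ i, H →L[ℝ] G i) (T : H →L[ℝ] H) (R : ∀ i, G i →L[ℝ] G i) :
    DirectSum H G →L[ℝ] DirectSum H G :=
  pairL (T ∘L fstP H G - ∑ i, (L i).adjoint ∘L sndP H G i)
    fun i => R i ∘L sndP H G i - L i ∘L fstP H G

@[simp] theorem metricOp_fst (L : ∀ i, H →L[ℝ] G i) (T : H →L[ℝ] H) (R : ∀ i, G i →L[ℝ] G i)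
    (k : DirectSum H G) :
    (metricOp L T R k).fst = T k.fst - ∑ i, (L i).adjoint (k.snd i) := by
  simp [metricOp, pairL_apply, sndP_apply, fstP_apply]

@[simp] theorem metricOp_snd (L : ∀ i, H →L[ℝ] G i) (T : H →L[ℝ] H) (R : ∀ i, G i →L[ℝ] G i)
    (k : DirectSum H G) (i : Fin m) :
    (metricOp L T R k).snd i = R i (k.snd i) - L i k.fst := rfl

theorem metricOp_symm {L : ∀ i, H →L[ℝ] G i} {T : H →L[ℝ] H} {R : ∀ i, G i →L[ℝ] G i}
    (hT : ∀ x y, ⟪T x, y⟫_ℝ = ⟪x, T y⟫_ℝ) (hR : ∀ i x y, ⟪R i x, y⟫_ℝ = ⟪x, R i y⟫_ℝ)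
    (k l : DirectSum H G) : ⟪metricOp L T R k, l⟫_ℝ = ⟪k, metricOp L T R l⟫_ℝ := by
  simp only [directSum_inner, metricOp_fst, metricOp_snd, inner_sub_left, inner_sub_right,
    sum_inner, inner_sum, ContinuousLinearMap.adjoint_inner_left,
    ContinuousLinearMap.adjoint_inner_right, Finset.sum_sub_distrib, hT, hR]
  ring

theorem inner_metricOp_self (L : ∀ i, H →L[ℝ] G i) (T : H →L[ℝ] H) (R : ∀ i, G i →L[ℝ] G i)
    (k : DirectSum H G) : ⟪metricOp L T R k, k⟫_ℝ =
      ⟪T k.fst, k.fst⟫_ℝ + ∑ i, ⟪R i (k.snd i), k.snd i⟫_ℝ - 2 * ∑ i, ⟪L i k.fst, k.snd i⟫_ℝ := by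
  simp only [directSum_inner, metricOp_fst, metricOp_snd, inner_sub_left, sum_inner,
    ContinuousLinearMap.adjoint_inner_left, Finset.sum_sub_distrib]
  simp only [real_inner_comm]
  ring

/-- In the variables `ξ = U^(-1/2) x` and `η i = (V i)^(-1/2) v i` the diagonal part is a sum of
squares and, by Cauchy-Schwarz, the coupling costs at most the fraction `s` of it. Returning to `k`
costs the factor `M`, and `ζ M = 1 - s`. -/
theorem zetaParam_mul_norm_sq_le {α : ℝ} (hα : 0 < α) {L : ∀ i, H →L[ℝ] G i} {U T : H →L[ℝ] H}
    {V R : ∀ i, G i →L[ℝ] G i} (hU : U ∈ coerciveOps α H) (hV : ∀ i, V i ∈ coerciveOps α (G i))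
    (hT : ∀ x, U (T x) = x) (hR : ∀ i x, V i (R i x) = x) (hζ : 0 < zetaParam L U V)
    (k : DirectSum H G) : zetaParam L U V * ‖k‖ ^ 2 ≤ ⟪metricOp L T R k, k⟫_ℝ := by
  set s := √(∑ i, ‖opSqrt (V i) ∘L L i ∘L opSqrt U‖ ^ 2) with hs
  set M := max ‖U‖ (⨆ i, ‖V i‖) with hM
  have hs0 : 0 ≤ s := Real.sqrt_nonneg _
  have hζe : zetaParam L U V = (s⁻¹ - 1) / (s⁻¹ * M) := by
    simp [zetaParam, deltaParam, hs, hM]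
  -- Division by zero returns `0`, so `M = 0` or `s = 0` would contradict `0 < ζ`.
  have hM0 : 0 < M := by
    refine lt_of_le_of_ne ((norm_nonneg U).trans (le_max_left _ _)) fun h => ?_
    rw [hζe, ← h] at hζ
    simp at hζ
  have hs1 : 0 < s := by
    refine lt_of_le_of_ne hs0 fun h => ?_
    rw [hζe, ← h] at hζ
    simp at hζ
  have hζM : zetaParam L U V * M = 1 - s := by
    rw [hζe]; field_simp
  set ξ := opSqrt U (T k.fst) with hξ
  set η : ∀ i, G i := fun i => opSqrt (V i) (R i (k.snd i)) with hη
  have hX : ‖ξ‖ ^ 2 = ⟪T k.fst, k.fst⟫_ℝ := by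
    rw [hξ, opSqrt_inner hα hU, hT, real_inner_comm]
  have hY : ∀ i, ‖η i‖ ^ 2 = ⟪R i (k.snd i), k.snd i⟫_ℝ := fun i => by
    rw [hη, opSqrt_inner hα (hV i), hR, real_inner_comm]
  have hcross : ∑ i, ⟪L i k.fst, k.snd i⟫_ℝ ≤ s * √(∑ i, ‖η i‖ ^ 2) * ‖ξ‖ := by
    have h1 : ∀ i, ⟪L i k.fst, k.snd i⟫_ℝ ≤
        ‖opSqrt (V i) ∘L L i ∘L opSqrt U‖ * ‖η i‖ * ‖ξ‖ := fun i => by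
      have h2 : k.fst = opSqrt U ξ := by rw [hξ, (opSqrt_spec hα hU).2, hT]
      have h3 : k.snd i = opSqrt (V i) (η i) := by rw [hη, (opSqrt_spec hα (hV i)).2, hR]
      rw [h3, ← inner_map_comm (opSqrt_spec hα (hV i)).1.isSelfAdjoint]
      nth_rewrite 1 [h2]
      calc _ ≤ ‖(opSqrt (V i) ∘L L i ∘L opSqrt U) ξ‖ * ‖η i‖ := real_inner_le_norm _ _
        _ ≤ (‖opSqrt (V i) ∘L L i ∘L opSqrt U‖ * ‖ξ‖) * ‖η i‖ := by
          gcongr; exact ContinuousLinearMap.le_opNorm _ _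
        _ = _ := by ring
    calc _ ≤ ∑ i, ‖opSqrt (V i) ∘L L i ∘L opSqrt U‖ * ‖η i‖ * ‖ξ‖ :=
          Finset.sum_le_sum fun i _ => h1 i
      _ = (∑ i, ‖opSqrt (V i) ∘L L i ∘L opSqrt U‖ * ‖η i‖) * ‖ξ‖ := by rw [Finset.sum_mul]
      _ ≤ _ := by
        gcongr
        exact Real.sum_mul_le_sqrt_mul_sqrt _ _ _
  have hYs : √(∑ i, ‖η i‖ ^ 2) ^ 2 = ∑ i, ‖η i‖ ^ 2 :=
    Real.sq_sqrt (Finset.sum_nonneg fun _ _ => sq_nonneg _)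
  have hlow : (1 - s) * (‖ξ‖ ^ 2 + ∑ i, ‖η i‖ ^ 2) ≤ ⟪metricOp L T R k, k⟫_ℝ := by
    rw [inner_metricOp_self, ← hX]
    simp only [← hY]
    have h4 : s * (2 * (√(∑ i, ‖η i‖ ^ 2) * ‖ξ‖)) ≤ s * (‖ξ‖ ^ 2 + ∑ i, ‖η i‖ ^ 2) := by
      gcongr
      nlinarith [sq_nonneg (√(∑ i, ‖η i‖ ^ 2) - ‖ξ‖)]
    linarith
  have hn : ‖k‖ ^ 2 ≤ M * (‖ξ‖ ^ 2 + ∑ i, ‖η i‖ ^ 2) := by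
    rw [directSum_norm_sq, mul_add, Finset.mul_sum]
    refine add_le_add ?_ (Finset.sum_le_sum fun i _ => ?_)
    · rw [hX]
      exact norm_sq_le_norm_mul_inner_inverse hα hU hT (le_max_left _ _) hM0 _
    · rw [hY]
      refine norm_sq_le_norm_mul_inner_inverse hα (hV i) (hR i) ?_ hM0 _
      exact (le_ciSup (f := fun i => ‖V i‖) (Set.finite_range _).bddAbove i).trans
        (le_max_right _ _)
  calc _ ≤ zetaParam L U V * (M * (‖ξ‖ ^ 2 + ∑ i, ‖η i‖ ^ 2)) := by gcongr
    _ = (1 - s) * (‖ξ‖ ^ 2 + ∑ i, ‖η i‖ ^ 2) := by rw [← mul_assoc, hζM]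
    _ ≤ _ := hlow

end Product

/-! ### From the primal-dual iteration to a forward-backward step -/

section Algorithm

/-- The bound on the relaxation parameters in terms of the coercivity constant `ζ` of the metric. -/
theorem relaxation_bound {β ε ζ lam t w : ℝ} (hε : 0 < ε) (hεβ : ε < min 1 β)
    (hζ : 1 / (2 * β - ε) ≤ ζ) (hlam : lam ≤ 1 + (1 - ε) * (1 - 1 / (2 * ζ * β))) (ht : 0 ≤ t)
    (hw : ζ * t ≤ w) :
    (1 / (2 * β) + ε ^ 2 / (2 * β) * (1 / (2 * β - ε))) * t ≤ (2 - lam) * w := by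
  obtain ⟨hε1, hεβ⟩ := lt_min_iff.1 hεβ
  have hβ : 0 < β := hε.trans hεβ
  have hd : 0 < 2 * β - ε := by linarith
  have hζ0 : 0 < ζ := (by positivity : 0 < 1 / (2 * β - ε)).trans_le hζ
  set κ := 1 / (2 * ζ * β) with hκ
  have hκζ : κ * ζ = 1 / (2 * β) := by rw [hκ]; field_simp
  have hκ1 : ε / (2 * β) ≤ 1 - κ := by
    have h1 : 1 ≤ ζ * (2 * β - ε) := (div_le_iff₀ hd).1 hζ
    have h2 : κ ≤ (2 * β - ε) / (2 * β) := by
      rw [hκ, div_le_div_iff₀ (by positivity) (by positivity)]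
      nlinarith
    have h3 : (2 * β - ε) / (2 * β) = 1 - ε / (2 * β) := by field_simp
    linarith
  -- Multiplied by `ζ`, the first term yields exactly `1 / (2 * β)`; the second, with `1 - κ ≥ ε /
  -- (2 * β)`, yields the slack.
  have h2 : κ + ε * (1 - κ) ≤ 2 - lam := by linarith
  have hκ0 : 0 < κ := by positivity
  have h1κ : 0 ≤ 1 - κ := le_trans (by positivity) hκ1
  calc _ ≤ (κ + ε * (1 - κ)) * ζ * t := by
        gcongr
        rw [add_mul, hκζ]
        refine add_le_add le_rfl ?_
        calc ε ^ 2 / (2 * β) * (1 / (2 * β - ε)) = ε * (ε / (2 * β)) * (1 / (2 * β - ε)) := by ring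
          _ ≤ ε * (1 - κ) * ζ := by gcongr
    _ = (κ + ε * (1 - κ)) * (ζ * t) := by ring
    _ ≤ (κ + ε * (1 - κ)) * w := by gcongr
    _ ≤ (2 - lam) * w := by
      have : 0 ≤ w := le_trans (by positivity) hw
      gcongr

theorem tendstoWeakly_fst {m : ℕ} {H : Type*} [NormedAddCommGroup H] [InnerProductSpace ℝ H]
    [CompleteSpace H]
    {G : Fin m → Type*} [∀ i, NormedAddCommGroup (G i)] [∀ i, InnerProductSpace ℝ (G i)]
    {w : ℕ → DirectSum H G} {l : DirectSum H G}
    (h : ∀ k, Tendsto (fun n => ⟪w n, k⟫_ℝ) atTop (𝓝 ⟪l, k⟫_ℝ)) :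
    TendstoWeakly (fun n => (w n).fst) l.fst := by
  refine tendstoWeakly_iff.2 fun y => ?_
  have e : ∀ k : DirectSum H G, ⟪k, pair y 0⟫_ℝ = ⟪k.fst, y⟫_ℝ := fun k => by
    rw [directSum_inner, Finset.sum_eq_zero fun i _ => ?_]
    · simp
    · exact inner_zero_right _
  simpa only [e] using h (pair y 0)

theorem tendstoWeakly_snd {m : ℕ} {H : Type*} [NormedAddCommGroup H] [InnerProductSpace ℝ H]
    {G : Fin m → Type*} [∀ i, NormedAddCommGroup (G i)] [∀ i, InnerProductSpace ℝ (G i)]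
    [∀ i, CompleteSpace (G i)]
    {w : ℕ → DirectSum H G} {l : DirectSum H G}
    (h : ∀ k, Tendsto (fun n => ⟪w n, k⟫_ℝ) atTop (𝓝 ⟪l, k⟫_ℝ)) (i : Fin m) :
    TendstoWeakly (fun n => (w n).snd i) (l.snd i) := by
  refine tendstoWeakly_iff.2 fun y => ?_
  have e : ∀ k : DirectSum H G, ⟪k, pair 0 (Pi.single i y)⟫_ℝ = ⟪k.snd i, y⟫_ℝ := fun k => by
    rw [directSum_inner, Finset.sum_eq_single i]
    · simp
    · intro j _ hj
      simp [Pi.single_eq_of_ne hj]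
    · simp
  simpa only [e] using h (pair 0 (Pi.single i y))

variable {m : ℕ} {H : Type*} [NormedAddCommGroup H] [InnerProductSpace ℝ H] [CompleteSpace H]
  {G : Fin m → Type*} [∀ i, NormedAddCommGroup (G i)] [∀ i, InnerProductSpace ℝ (G i)]
  [∀ i, CompleteSpace (G i)] {z : H} {A : H → Set H} {C : H → H} {B D : ∀ i, G i → Set (G i)}
  {L : ∀ i, H →L[ℝ] G i} {r : ∀ i, G i} {E : ∀ i, G i → G i}

theorem mem_parallelSum_iff {X : Type*} [NormedAddCommGroup X] [InnerProductSpace ℝ X]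
    {B D : X → Set X} {E : X → X} (hE : ∀ v w, w ∈ inv D v ↔ w = E v) {v y : X} :
    v ∈ parallelSum B D y ↔ y - E v ∈ inv B v := by
  have h : inv D v = {E v} := Set.ext fun w => hE v w
  change y ∈ inv B v + inv D v ↔ _
  rw [h, Set.add_singleton, Set.image_add_right, Set.mem_preimage, sub_eq_add_neg]

theorem isPrimalSolution_iff {x : H} : IsPrimalSolution z A C B D L r x ↔
    ∃ v : ∀ i, G i, (∀ i, v i ∈ parallelSum (B i) (D i) (L i x - r i)) ∧
      z - ∑ i, (L i).adjoint (v i) - C x ∈ A x := by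
  simp only [IsPrimalSolution, primalOp, Set.mem_add, Set.mem_finsetSum, Set.mem_singleton_iff]
  constructor
  · rintro ⟨_, ⟨u, hu, _, ⟨g, hg, rfl⟩, rfl⟩, _, rfl, rfl⟩
    choose v hv hvg using fun i => hg (Finset.mem_univ i)
    refine ⟨v, hv, ?_⟩
    simp only [hvg]
    convert hu using 1
    abel
  · rintro ⟨v, hv, hx⟩
    refine ⟨_, ⟨_, hx, _, ⟨fun i => (L i).adjoint (v i), fun {i} _ => ⟨v i, hv i, rfl⟩, rfl⟩, rfl⟩,
      C x, rfl, ?_⟩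
    abel

/-- A zero carries a primal and a dual solution at once; conversely, every primal solution extends
to a zero by `isPrimalSolution_iff`. -/
theorem zero_iff (hE : ∀ i v w, w ∈ inv (D i) v ↔ w = E i v) {k : DirectSum H G} :
    -skewOp L k - cocoOp C E k ∈ monoOp z A B r k ↔
      z - ∑ i, (L i).adjoint (k.snd i) - C k.fst ∈ A k.fst ∧
      ∀ i, k.snd i ∈ parallelSum (B i) (D i) (L i k.fst - r i) := by
  simp only [monoOp, Set.mem_ofPred_eq, mem_parallelSum_iff (hE _)]
  have e₀ : (-skewOp L k - cocoOp C E k).fst + z =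
      z - ∑ i, (L i).adjoint (k.snd i) - C k.fst := by
    simp only [WithLp.sub_fst, WithLp.neg_fst, skewOp_fst, cocoOp, pair_fst]
    abel
  have e : ∀ i, (-skewOp L k - cocoOp C E k).snd i - r i =
      L i k.fst - r i - E i (k.snd i) := fun i => by
    simp only [WithLp.sub_snd, WithLp.neg_snd, PiLp.sub_apply, PiLp.neg_apply, skewOp_snd, cocoOp,
      pair_snd]
    abel
  simp only [e₀, e]

theorem existsUnique_isStep {α : ℝ} (hα : 0 < α) (hA : IsMaximallyMonotone A)
    (hB : ∀ i, IsMaximallyMonotone (B i)) (hE : ∀ i v w, w ∈ inv (D i) v ↔ w = E i v)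
    {U : H →L[ℝ] H} {V : ∀ i, G i →L[ℝ] G i} (hU : U ∈ coerciveOps α H)
    (hV : ∀ i, V i ∈ coerciveOps α (G i)) (lam : ℝ) (a c : H) (b d : ∀ i, G i) (x : H)
    (v : ∀ i, G i) :
    ∃! p : H × (∀ i, G i), IsStep z A C B D L r U V lam a c b d x v p.1 p.2 := by
  obtain ⟨p, hp, hpu⟩ := existsUnique_mem_resolvent hα hU hA
    (x - U (∑ i, (L i).adjoint (v i) + C x + c - z))
  choose q hq hqu using fun i => existsUnique_mem_resolvent hα (hV i) (hB i).inv
    (v i + V i (L i ((2 : ℝ) • (p + a) - x) - E i (v i) - d i - r i))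
  refine ⟨(x + lam • (p + a - x), fun i => v i + lam • (q i + b i - v i)), ?_, ?_⟩
  · refine ⟨p + a, _, by rwa [add_sub_cancel_right], rfl, rfl, fun i => ?_⟩
    exact ⟨E i (v i), q i + b i, (hE i _ _).2 rfl, by rw [add_sub_cancel_right]; exact hq i, rfl⟩
  · rintro ⟨x', v'⟩ ⟨p', y', hp', rfl, rfl, hv'⟩
    obtain rfl : p' = p + a := sub_eq_iff_eq_add.1 (hpu _ hp')
    refine Prod.ext rfl (funext fun i => ?_)
    obtain ⟨w, q', hw, hq', e⟩ := hv' i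
    obtain rfl := (hE i _ _).1 hw
    obtain rfl : q' = q i + b i := sub_eq_iff_eq_add.1 (hqu i _ hq')
    exact e

theorem existsUnique_isGenerated {U : ℕ → H →L[ℝ] H} {V : ∀ i, ℕ → G i →L[ℝ] G i} {lam : ℕ → ℝ}
    {a c : ℕ → H} {b d : ∀ i, ℕ → G i}
    (hstep : ∀ n x v, ∃! p : H × (∀ i, G i), IsStep z A C B D L r (U n) (fun i => V i n) (lam n)
      (a n) (c n) (fun i => b i n) (fun i => d i n) x v p.1 p.2) (x₀ : H) (v₀ : ∀ i, G i) :
    ∃! s : ℕ → H × (∀ i, G i), IsGenerated z A C B D L r U V lam a c b d x₀ v₀ s := by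
  choose next hnext huniq using hstep
  refine ⟨fun n => Nat.rec (x₀, v₀) (fun n p => next n p.1 p.2) n, ⟨rfl, fun n => hnext n _ _⟩, ?_⟩
  rintro s ⟨hs0, hs⟩
  funext n
  induction n with
  | zero => exact hs0
  | succ n ih =>
    change s (n + 1) = next n _ _
    rw [← ih]
    exact huniq n _ _ _ (hs n)

/-- A step of the algorithm is a forward-backward step in the direct sum, in the metric
`metricOp L U⁻¹ V⁻¹`. -/
theorem IsStep.exists_mem_monoOp (hE : ∀ i v w, w ∈ inv (D i) v ↔ w = E i v)
    {U T : H →L[ℝ] H} {V R : ∀ i, G i →L[ℝ] G i} (hUT : ∀ x, U (T x) = x)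
    (hTU : ∀ x, T (U x) = x) (hVR : ∀ i x, V i (R i x) = x) (hRV : ∀ i x, R i (V i x) = x)
    {lam : ℝ} {a c : H} {b d : ∀ i, G i} {x x' : H} {v v' : ∀ i, G i}
    (h : IsStep z A C B D L r U V lam a c b d x v x' v') :
    ∃ k : DirectSum H G, metricOp L T R (pair x v - k) - skewOp L k - cocoOp C E (pair x v)
        - pair c (fun i => d i - (2 : ℝ) • L i a) ∈ monoOp z A B r k ∧
      pair x' v' = pair x v + lam • (k + pair a b - pair x v) := by
  obtain ⟨p, _, hp, rfl, rfl, hv'⟩ := h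
  choose w q hw hq hv' using hv'
  obtain rfl : w = fun i => E i (v i) := funext fun i => (hE i _ _).1 (hw i)
  obtain rfl : v' = fun i => v i + lam • (q i - v i) := funext hv'
  refine ⟨pair (p - a) fun i => q i - b i, ⟨?_, fun i => ?_⟩, ?_⟩
  · rw [mem_resolvent_linComp_iff hUT hTU] at hp
    -- In this component the off-diagonal part of the metric cancels the dependence of `skewOp` on
    -- the new dual point.
    have e : (metricOp L T R (pair x v - pair (p - a) fun i => q i - b i)
        - skewOp L (pair (p - a) fun i => q i - b i) - cocoOp C E (pair x v)
        - pair c (fun i => d i - (2 : ℝ) • L i a)).fst + z =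
        T (x - U (∑ i, (L i).adjoint (v i) + C x + c - z) - (p - a)) := by
      simp only [WithLp.sub_fst, metricOp_fst, skewOp_fst, cocoOp, pair_fst, pair_snd,
        map_sub, hTU, Finset.sum_sub_distrib]
      abel
    exact e ▸ hp
  · have hqi := hq i
    rw [mem_resolvent_linComp_iff (hVR i) (hRV i)] at hqi
    -- Here the two contributions of `L i` add up to `L i (2 (p - a) - x)`, the source of the
    -- extrapolation; since the algorithm uses `p` and not `p - a`, the error `2 L i a` appears.
    have e : (metricOp L T R (pair x v - pair (p - a) fun i => q i - b i)
        - skewOp L (pair (p - a) fun i => q i - b i) - cocoOp C E (pair x v)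
        - pair c (fun i => d i - (2 : ℝ) • L i a)).snd i - r i =
        R i (v i + V i (L i ((2 : ℝ) • p - x) - E i (v i) - d i - r i) - (q i - b i)) := by
      simp only [metricOp_snd, skewOp_snd, cocoOp, pair_fst, WithLp.sub_snd,
      PiLp.sub_apply, pair_snd, map_sub, map_add, hRV, two_smul]
      abel
    exact e ▸ hqi
  · simp only [← WithLp.toLp_add, pair, ← WithLp.toLp_sub, ← WithLp.toLp_smul, Prod.mk_add_mk,
      Prod.mk_sub_mk, Prod.smul_mk, sub_add_cancel]
    congr 3
    funext i
    simp

end Algorithm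

end PrimalDual

/-! ### The convergence theorem -/

theorem corollary5p2 {m : ℕ} (hm : 0 < m)
    {H : Type*} [NormedAddCommGroup H] [InnerProductSpace ℝ H] [CompleteSpace H]
    {G : Fin m → Type*} [∀ i, NormedAddCommGroup (G i)] [∀ i, InnerProductSpace ℝ (G i)]
    [∀ i, CompleteSpace (G i)]
    -- the problem
    (z : H) (A : H → Set H) (hA : PrimalDual.IsMaximallyMonotone A)
    (μ : ℝ) (hμ : 0 < μ) (C : H → H) (hC : PrimalDual.IsCocoercive μ C)
    (r : ∀ i, G i)
    (B : ∀ i, G i → Set (G i)) (hB : ∀ i, PrimalDual.IsMaximallyMonotone (B i))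
    (ν : Fin m → ℝ) (hν : ∀ i, 0 < ν i)
    (D : ∀ i, G i → Set (G i)) (hD : ∀ i, PrimalDual.IsMaximallyMonotone (D i))
    (hDν : ∀ i, PrimalDual.IsStronglyMonotone (ν i) (D i))
    (L : ∀ i, H →L[ℝ] G i) (hL : ∀ i, L i ≠ 0)
    (hz : z ∈ PrimalDual.ran (PrimalDual.primalOp A C B D L r))
    -- the parameters
    (β : ℝ) (hβ : β = min μ (⨅ i, ν i))
    (ε : ℝ) (hε : 0 < ε) (hε' : ε < min 1 β)
    (α : ℝ) (hα : 0 < α)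
    (lam : ℕ → ℝ) (x₀ : H)
    (a c : ℕ → H) (ha : Summable fun n => ‖a n‖) (hc : Summable fun n => ‖c n‖)
    (U : ℕ → H →L[ℝ] H) (hU : ∀ n, U n ∈ PrimalDual.coerciveOps α H)
    (hUmono : ∀ n, U n ≤ U (n + 1))
    (v₀ : ∀ i, G i)
    (b d : ∀ i, ℕ → G i) (hb : ∀ i, Summable fun n => ‖b i n‖)
    (hd : ∀ i, Summable fun n => ‖d i n‖)
    (V : ∀ i, ℕ → G i →L[ℝ] G i) (hV : ∀ i n, V i n ∈ PrimalDual.coerciveOps α (G i))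
    (hVmono : ∀ i n, V i n ≤ V i (n + 1))
    (hζ : ∀ n, 1 / (2 * β - ε) ≤ PrimalDual.zetaParam L (U n) (fun i => V i n))
    (hlam : ∀ n, lam n ∈ Set.Icc ε
      (1 + (1 - ε) * (1 - 1 / (2 * PrimalDual.zetaParam L (U n) (fun i => V i n) * β)))) :
    -- the algorithm generates exactly one sequence
    (∃! s : ℕ → H × (∀ i, G i),
      PrimalDual.IsGenerated z A C B D L r U V lam a c b d x₀ v₀ s) ∧
    -- and this sequence converges
    ∀ s : ℕ → H × (∀ i, G i),
      PrimalDual.IsGenerated z A C B D L r U V lam a c b d x₀ v₀ s →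
      ∃ (xbar : H) (vbar : ∀ i, G i),
        PrimalDual.IsPrimalSolution z A C B D L r xbar ∧
        PrimalDual.IsDualSolution z A C B D L r vbar ∧
        PrimalDual.TendstoWeakly (fun n => (s n).1) xbar ∧
        (∀ i, PrimalDual.TendstoWeakly (fun n => (s n).2 i) (vbar i)) ∧
        (PrimalDual.IsDemiregularAt (PrimalDual.ofFun C) xbar →
          Filter.Tendsto (fun n => (s n).1) Filter.atTop (nhds xbar)) ∧
        (∀ j, PrimalDual.IsDemiregularAt (PrimalDual.inv (D j)) (vbar j) →
          Filter.Tendsto (fun n => (s n).2 j) Filter.atTop (nhds (vbar j))) := by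

  have hεβ := hε'
  obtain ⟨hε1, hε2⟩ := lt_min_iff.1 hε'
  have hβ0 : 0 < β := hε.trans hε2
  have hd0 : 0 < 2 * β - ε := by linarith
  have hρ0 : 0 < 1 / (2 * β - ε) := by positivity
  choose E hE hEco using fun i =>
    PrimalDual.exists_inv_eq_of_stronglyMonotone (hν i) (hD i) (hDν i)
  choose T hUT hTU using fun n => PrimalDual.exists_inverse_of_mem_coerciveOps hα (hU n)
  choose R hVR hRV using fun n i => PrimalDual.exists_inverse_of_mem_coerciveOps hα (hV i n)
  refine ⟨PrimalDual.existsUnique_isGenerated (fun n x v =>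
    PrimalDual.existsUnique_isStep hα hA hB hE (hU n) (fun i => hV i n) _ _ _ _ _ _ _) x₀ v₀, ?_⟩
  rintro s ⟨-, hs⟩
  choose v' hv' hup using fun n => (hs n).exists_mem_monoOp hE (hUT n) (hTU n) (hVR n) (hRV n)
  -- The exact step is the algorithm run from the same point with zero errors; the relaxation `1` is
  -- immaterial to it.
  have hexact : ∀ n, ∃ k, PrimalDual.metricOp L (T n) (R n)
      (PrimalDual.pair (s n).1 (s n).2 - k) - PrimalDual.skewOp L k
        - PrimalDual.cocoOp C E (PrimalDual.pair (s n).1 (s n).2) ∈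
      PrimalDual.monoOp z A B r k := fun n => by
    obtain ⟨p, hp, -⟩ := PrimalDual.existsUnique_isStep (z := z) (C := C) (L := L) (r := r) hα hA hB
      hE (hU n) (fun i => hV i n) 1 0 0 0 0 (s n).1 (s n).2
    obtain ⟨k, hk, -⟩ := hp.exists_mem_monoOp hE (hUT n) (hTU n) (hVR n) (hRV n)
    refine ⟨k, ?_⟩
    have e : PrimalDual.pair (0 : H) (fun i => (0 : ∀ i, G i) i - (2 : ℝ) • L i 0) = 0 := by
      simp only [map_zero, smul_zero, sub_zero]
      rfl
    rwa [e, sub_zero] at hk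
  choose v hv using hexact
  have hcoer : ∀ n k, PrimalDual.zetaParam L (U n) (fun i => V i n) * ‖k‖ ^ 2 ≤
      inner ℝ (PrimalDual.metricOp L (T n) (R n) k) k := fun n k =>
    PrimalDual.zetaParam_mul_norm_sq_le hα (hU n) (fun i => hV i n) (hUT n) (hVR n)
      (hρ0.trans_le (hζ n)) k
  have hFB : PrimalDual.IsForwardBackward (PrimalDual.monoOp z A B r) (PrimalDual.skewOp L)
      (PrimalDual.cocoOp C E) (fun n => PrimalDual.metricOp L (T n) (R n)) lam
      (fun n => PrimalDual.pair (s n).1 (s n).2) v v'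
      (fun n => PrimalDual.pair (c n) fun i => d i n - (2 : ℝ) • L i (a n))
      (fun n => PrimalDual.pair (a n) fun i => b i n) β (1 / (2 * β - ε))
      (ε ^ 2 / (2 * β) * (1 / (2 * β - ε))) ε :=
    { maximal := PrimalDual.isMaximallyMonotone_monoOp hA hB
      skew := PrimalDual.inner_skewOp L
      cocoercive := PrimalDual.isCocoercive_cocoOp hC hEco (hβ ▸ min_le_left _ _) fun i =>
        hβ ▸ (min_le_right _ _).trans (ciInf_le (Set.finite_range _).bddBelow i)
      beta_pos := hβ0
      rho_pos := hρ0
      sigma_pos := by positivity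
      eps_pos := hε
      symm := fun n => PrimalDual.metricOp_symm
        (PrimalDual.inverse_isSelfAdjoint (hU n).1 (hUT n)) fun i =>
          PrimalDual.inverse_isSelfAdjoint (hV i n).1 (hVR n i)
      coercive := fun n k => (mul_le_mul_of_nonneg_right (hζ n) (sq_nonneg _)).trans (hcoer n k)
      succ_le := fun n k => by
        rw [PrimalDual.inner_metricOp_self, PrimalDual.inner_metricOp_self]
        gcongr
        · exact PrimalDual.inner_inverse_antitone hα (hU n) (hUmono n) (hUT n) (hUT (n + 1)) _
        · exact PrimalDual.inner_inverse_antitone hα (hV _ n) (hVmono _ n) (hVR n _)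
            (hVR (n + 1) _) _
      relax := fun n k => PrimalDual.relaxation_bound hε hε' (hζ n) (hlam n).2 (sq_nonneg _)
        (hcoer n k)
      le_lam := fun n => (hlam n).1
      lam_le := fun n => by
        have h1 := (hlam n).2
        have h2 : 0 < PrimalDual.zetaParam L (U n) (fun i => V i n) := hρ0.trans_le (hζ n)
        have h3 : 0 < 1 / (2 * PrimalDual.zetaParam L (U n) (fun i => V i n) * β) := by positivity
        nlinarith
      summable_e := by
        refine PrimalDual.summable_norm_pair (v := fun i n => d i n - (2 : ℝ) • L i (a n)) hc
          fun i => ?_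
        refine .of_nonneg_of_le (fun _ => norm_nonneg _) (fun n => ?_)
          ((hd i).add (ha.mul_left (2 * ‖L i‖)))
        refine (norm_sub_le _ _).trans (add_le_add le_rfl ?_)
        rw [norm_smul, Real.norm_ofNat, mul_assoc]
        gcongr
        exact (L i).le_opNorm _
      summable_f := PrimalDual.summable_norm_pair ha hb
      exact_step := hv
      inexact_step := hv'
      update := hup }
  obtain ⟨x, hx⟩ := hz
  obtain ⟨u, hu, hxu⟩ := PrimalDual.isPrimalSolution_iff.1 hx
  obtain ⟨l, hl, hw, hQ⟩ := hFB.exists_tendsto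
    ⟨PrimalDual.pair x u, (PrimalDual.zero_iff hE).2 ⟨hxu, hu⟩⟩
  obtain ⟨hl1, hl2⟩ := (PrimalDual.zero_iff hE).1 hl
  have hw1 : PrimalDual.TendstoWeakly (fun n => (s n).1) l.fst := PrimalDual.tendstoWeakly_fst (w := fun n => PrimalDual.pair (s n).1 (s n).2) hw
  have hw2 : ∀ i, PrimalDual.TendstoWeakly (fun n => (s n).2 i) (l.snd i) :=
    PrimalDual.tendstoWeakly_snd (w := fun n => PrimalDual.pair (s n).1 (s n).2) hw
  refine ⟨l.fst, l.snd, PrimalDual.isPrimalSolution_iff.2 ⟨_, hl2, hl1⟩, ⟨l.fst, ?_, hl2⟩, hw1, hw2,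
    fun hreg => ?_, fun j hreg => ?_⟩
  · exact Set.mem_add.2 ⟨_, hl1, _, rfl, sub_add_cancel _ _⟩
  -- The strong convergence `hQ` projects onto each component, which supplies the convergent images
  -- required by demiregularity.
  · exact hreg.2 _ (fun n => C (s n).1) _ (fun n => rfl) rfl hw1
      (((PrimalDual.fstP H G).continuous.tendsto _).comp hQ)
  · exact hreg.2 _ (fun n => E j ((s n).2 j)) (E j (l.snd j)) (fun n => (hE j _ _).2 rfl)
      ((hE j _ _).2 rfl) (hw2 j) (((PrimalDual.sndP H G j).continuous.tendsto _).comp hQ)
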